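/- Let $G$ be a finite group and $p$ a prime. Let $R$ be the ring of all algebraic integers, $K\subset\mathbb{C}$ its field of fractions (the field of algebraic numbers), $I$ a maximal ideal of $R$ containing $p$, and $F=R/I$. Brauer characters of $G$ are taken with respect to $(K,R,F)$ and regarded as $K$-valued functions on $G$ that vanish on $p$-singular elements. Let $\mathrm{Irr}(G)$ and $\mathrm{IBr}(G)$ denote the sets of irreducible ordinary ($K$-)characters and irreducible Brauer characters. The decomposition numbers $d_{\chi\varphi}\in\mathbb{Z}_{\ge 0}$ are defined by $\hat\chi=\sum_{\varphi\in\mathrm{IBr}(G)}d_{\chi\varphi}\varphi$ for $\chi\in\mathrm{Irr}(G)$, where $\hat\chi$ agrees with $\chi$ on $p$-regular elements and is $0$ on $p$-singular ones. The projective indecomposable characters (PIMs) are $\Phi_\varphi=\sum_{\chi\in\mathrm{Irr}(G)}d_{\chi\varphi}\chi$, $\varphi\in\mathrm{IBr}(G)$; a (genuine) projective character is a linear combination of PIMs with non-negative integer coefficients. Let $\langle\lambda,\mu\rangle=\frac1{|G|}\sum_{g\in G}\lambda(g)\overline{\mu(g)}$. The blocks of $G$ are the connected components of the graph on $\mathrm{Irr}(G)$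 in which distinct $\chi,\psi$ are adjacent if $d_{\chi\varphi}\neq0\neq d_{\psi\varphi}$ for some $\varphi\in\mathrm{IBr}(G)$. Let $B$ be a union of blocks, $\mathrm{Irr}(B)$ the set of its ordinary irreducible characters, $\mathrm{IBr}(B)$ the set of $\varphi\in\mathrm{IBr}(G)$ with $d_{\chi\varphi}\ne0$ for some $\chi\in\mathrm{Irr}(B)$, and $\mathrm{IPr}(B)=\{\Phi_\varphi:\varphi\in\mathrm{IBr}(B)\}$. Let $G_0(\hat B)$ and $K_0(B)$ be the $\mathbb{Z}$-spans of $\mathrm{IBr}(B)$ and $\mathrm{IPr}(B)$. A basic set of Brauer characters is a $\mathbb{Z}$-basis of $G_0(\hat B)$ consisting of Brauer characters afforded by $F$-representations of $G$. A system of projective atoms is a $\mathbb{Z}$-basis of $K_0(B)$ such that every projective character lying in $K_0(B)$ is a linear combination of its elements with non-negative integer coefficients. (1) Let $\mathbf{BS}$ be a basic set of Brauer characters of $B$. There is exactly one $\mathbb{Z}$-basis $\mathbf{PA}$ of $K_0(B)$ dual to $\mathbf{BS}$ with respect to $\langle\ ,\ \rangle$, and it is a system of projective atoms. (2) Let $\mathbf{PA}$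 be a system of projective atoms of $B$. If $\Phi\in\mathbf{PA}$ is a genuine projective character, then $\Phi$ is indecomposable (nonzero, and not a sum of two nonzero projective characters) and is a PIM, i.e. $\Phi\in\mathrm{IPr}(B)$. -/

import Mathlib

namespace BrauerAtoms

/-- The field `K` of algebraic numbers, as a subfield of `ℂ`. -/
noncomputable abbrev K : IntermediateField ℚ ℂ := algebraicClosure ℚ ℂ

/-- The ring `R` of all algebraic integers; its field of fractions is `K`. -/
noncomputable abbrev R : Subalgebra ℤ K := integralClosure ℤ K

/-- The residue class field `F = R / I` at a maximal ideal `I` of `R`. -/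
abbrev F (I : Ideal R) : Type := R ⧸ I

noncomputable instance instFieldF (I : Ideal R) [I.IsMaximal] : Field (F I) :=
  Ideal.Quotient.field I

/-- The `p'`-part of the order of `G`. -/
noncomputable def pPrimePart (p : ℕ) (G : Type*) : ℕ := ordCompl[p] (Nat.card G)

/-- If `p ∈ I` and `p ∤ m`, reduction modulo `I` is a bijection from the `m`-th roots of unity
in `R` onto the `m`-th roots of unity in `F`. -/
theorem existsUnique_rootOfUnity_lift {p : ℕ} (hp : p.Prime) (I : Ideal R) [I.IsMaximal]
    (hpI : (p : R) ∈ I) {m : ℕ} (hm : ¬ p ∣ m) (ζ : F I) (hζ : ζ ^ m = 1) :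
    ∃! z : R, z ^ m = 1 ∧ Ideal.Quotient.mk I z = ζ := by
  have hm0 : 0 < m := Nat.pos_of_ne_zero fun h => hm (h ▸ dvd_zero p)
  have : NeZero m := ⟨hm0.ne'⟩
  have : IsAlgClosed K := 
    (algebraicClosure.isAlgClosure ℚ ℂ).isAlgClosed
  have : NeZero ((m : ℕ) : K) := ⟨by exact_mod_cast hm0.ne'⟩
  obtain ⟨w, hw⟩ := HasEnoughRootsOfUnity.exists_primitiveRoot K m
  have hwint : IsIntegral ℤ w := hw.isIntegral hm0
  have hw' : IsPrimitiveRoot (⟨w, hwint⟩ : R) m :=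
    IsPrimitiveRoot.of_map_of_injective (f := R.val) hw Subtype.val_injective
  have hprod := congrArg (Polynomial.map (Ideal.Quotient.mk I))
    (Polynomial.X_pow_sub_one_eq_prod hm0 hw')
  simp only [Polynomial.map_sub, Polynomial.map_pow, Polynomial.map_X, Polynomial.map_one,
    Polynomial.map_prod, Polynomial.map_C] at hprod
  have hmF : (m : F I) ≠ 0 := by
    intro h0
    have hmI : (m : R) ∈ I := by
      rw [← Ideal.Quotient.eq_zero_iff_mem]
      simpa using h0
    have hcop : IsCoprime (m : ℤ) (p : ℤ) :=
      Nat.isCoprime_iff_coprime.mpr ((Nat.Prime.coprime_iff_not_dvd hp).mpr hm).symm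
    obtain ⟨a, b, hab⟩ := hcop
    have h1 : (1 : R) = (a : R) * (m : R) + (b : R) * (p : R) := by exact_mod_cast hab.symm
    have : (1 : R) ∈ I := h1 ▸ I.add_mem (I.mul_mem_left _ hmI) (I.mul_mem_left _ hpI)
    exact (Ideal.ne_top_iff_one I).mp (Ideal.IsMaximal.ne_top inferInstance) this
  have hsep : (Polynomial.X ^ m - 1 : Polynomial (F I)).Separable :=
    (Polynomial.X_pow_sub_one_separable_iff).mpr hmF
  rw [hprod] at hsep
  have hinj := Polynomial.separable_prod_X_sub_C_iff'.mp hsep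
  have hex : ∃ z ∈ Polynomial.nthRootsFinset m (1 : R), ζ - Ideal.Quotient.mk I z = 0 := by
    have := congrArg (Polynomial.eval ζ) hprod
    simp only [Polynomial.eval_sub, Polynomial.eval_pow, Polynomial.eval_X, Polynomial.eval_one,
      Polynomial.eval_prod, Polynomial.eval_C, hζ, sub_self] at this
    exact Finset.prod_eq_zero_iff.mp this.symm
  obtain ⟨z, hz, hzζ⟩ := hex
  refine ⟨z, ⟨(Polynomial.mem_nthRootsFinset hm0 _).mp hz, (sub_eq_zero.mp hzζ).symm⟩, ?_⟩
  rintro y ⟨hy, hyζ⟩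
  exact hinj y ((Polynomial.mem_nthRootsFinset hm0 _).mpr hy) z hz
    (hyζ.trans (sub_eq_zero.mp hzζ))

open Classical in
/-- The inverse of reduction modulo `I` on `m`-th roots of unity (only applied to `m`-th roots of
unity with `m` prime to `p`, where it is well defined by `existsUnique_rootOfUnity_lift`). -/
noncomputable def rootLift (I : Ideal R) (m : ℕ) (ζ : F I) : K :=
  if h : ∃ z : R, z ^ m = 1 ∧ Ideal.Quotient.mk I z = ζ then ((h.choose : R) : K) else 0

section

variable {G : Type*} [Group G]

/-- The Brauer character afforded by an `F`-representation of `G`: at a `p`-regular element it is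
the sum of the lifts of the eigenvalues, with multiplicity; it is extended by `0` to the
`p`-singular elements. -/
noncomputable def brauerCharacter (p : ℕ) (I : Ideal R) [I.IsMaximal] {n : ℕ}
    (X : Representation (F I) G (Fin n → F I)) : G → K := fun g =>
  if p ∣ orderOf g then 0
  else ((X g).charpoly.roots.map (rootLift I (pPrimePart p G))).sum

/-- `θ` is a (genuine) Brauer character of `G`. -/
def IsBrauerCharacter (p : ℕ) (I : Ideal R) [I.IsMaximal] (θ : G → K) : Prop :=
  ∃ (n : ℕ) (X : Representation (F I) G (Fin n → F I)), θ = brauerCharacter p I X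

variable (G) in
/-- `Irr(G)`: the irreducible ordinary `K`-characters of `G`. -/
def Irr : Set (G → K) :=
  {χ | ∃ (n : ℕ) (X : Representation K G (Fin n → K)), X.IsIrreducible ∧ χ = X.character}

variable (G) in
/-- `IBr(G)`: the irreducible Brauer characters of `G`. -/
def IBr (p : ℕ) (I : Ideal R) [I.IsMaximal] : Set (G → K) :=
  {φ | ∃ (n : ℕ) (X : Representation (F I) G (Fin n → F I)),
    X.IsIrreducible ∧ φ = brauerCharacter p I X}

/-- The function that agrees with `χ` on `p`-regular elements and is `0` on `p`-singular ones. -/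
noncomputable def hat (p : ℕ) (χ : G → K) : G → K := fun g => if p ∣ orderOf g then 0 else χ g

/-- `d` is the family of multiplicities in an expression `χ̂ = ∑ φ ∈ IBr(G), d φ • φ`. -/
def IsDecomposition (p : ℕ) (I : Ideal R) [I.IsMaximal] (χ : G → K) (d : (G → K) →₀ ℕ) : Prop :=
  (d.support : Set (G → K)) ⊆ IBr G p I ∧ hat p χ = d.sum fun φ k => k • φ

open Classical in
/-- The decomposition number `d_{χφ}`: the coefficient of `φ` in the (unique) expression of `χ̂`
as a combination of irreducible Brauer characters. -/
noncomputable def decompositionNumber (p : ℕ) (I : Ideal R) [I.IsMaximal] (χ φ : G → K) : ℕ :=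
  if h : ∃ d, IsDecomposition p I χ d then h.choose φ else 0

/-- The projective indecomposable character `Φ_φ = ∑ χ ∈ Irr(G), d_{χφ} χ`. -/
noncomputable def PIM (p : ℕ) (I : Ideal R) [I.IsMaximal] (φ : G → K) : G → K :=
  ∑ᶠ χ ∈ Irr G, decompositionNumber p I χ φ • χ

variable (G) in
/-- `IPr(G)`: the set of all PIMs of `G`. -/
def IPr (p : ℕ) (I : Ideal R) [I.IsMaximal] : Set (G → K) := PIM p I '' IBr G p I

/-- `Φ` is a (genuine) projective character: a combination of PIMs with coefficients in `ℕ`. -/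
def IsProjectiveCharacter (p : ℕ) (I : Ideal R) [I.IsMaximal] (Φ : G → K) : Prop :=
  Φ ∈ AddSubmonoid.closure (IPr G p I)

/-- `Φ` is an indecomposable projective character: a nonzero projective character which is not
the sum of two nonzero projective characters. -/
def IsIndecomposable (p : ℕ) (I : Ideal R) [I.IsMaximal] (Φ : G → K) : Prop :=
  IsProjectiveCharacter p I Φ ∧ Φ ≠ 0 ∧
    ∀ Ψ₁ Ψ₂ : G → K, IsProjectiveCharacter p I Ψ₁ → IsProjectiveCharacter p I Ψ₂ →
      Φ = Ψ₁ + Ψ₂ → Ψ₁ = 0 ∨ Ψ₂ = 0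

variable (G) in
/-- The Brauer graph: its vertices are the irreducible ordinary characters, two of which are
linked if they have a common irreducible Brauer constituent. -/
def brauerGraph (p : ℕ) (I : Ideal R) [I.IsMaximal] : SimpleGraph (Irr G) where
  Adj χ ψ := χ ≠ ψ ∧ ∃ φ ∈ IBr G p I,
    decompositionNumber p I χ.1 φ ≠ 0 ∧ decompositionNumber p I ψ.1 φ ≠ 0
  symm := ⟨fun _ _ h => ⟨h.1.symm, h.2.imp fun _ hφ => ⟨hφ.1, hφ.2.2, hφ.2.1⟩⟩⟩
  loopless := ⟨fun _ h => h.1 rfl⟩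

/-- A `p`-block of `G`: the set of characters in a connected component of the Brauer graph. -/
def IsBlock (p : ℕ) (I : Ideal R) [I.IsMaximal] (b : Set (Irr G)) : Prop :=
  ∃ c : (brauerGraph G p I).ConnectedComponent, b = c.supp

/-- `B`, given by its set `Irr(B)` of ordinary irreducible characters, is a union of blocks. -/
def IsUnionOfBlocks (p : ℕ) (I : Ideal R) [I.IsMaximal] (B : Set (Irr G)) : Prop :=
  ∃ S : Set (Set (Irr G)), (∀ b ∈ S, IsBlock p I b) ∧ B = ⋃₀ S

/-- `IBr(B)`: the irreducible Brauer characters belonging to `B`. -/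
def IBrOf (p : ℕ) (I : Ideal R) [I.IsMaximal] (B : Set (Irr G)) : Set (G → K) :=
  {φ | φ ∈ IBr G p I ∧ ∃ χ ∈ B, decompositionNumber p I χ.1 φ ≠ 0}

/-- `IPr(B)`: the PIMs belonging to `B`. -/
def IPrOf (p : ℕ) (I : Ideal R) [I.IsMaximal] (B : Set (Irr G)) : Set (G → K) :=
  PIM p I '' IBrOf p I B

/-- `G₀(B̂)`: the generalized Brauer characters of `B`. -/
noncomputable def G₀ (p : ℕ) (I : Ideal R) [I.IsMaximal] (B : Set (Irr G)) : Submodule ℤ (G → K) :=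
  Submodule.span ℤ (IBrOf p I B)

/-- `K₀(B)`: the generalized projective characters of `B`. -/
noncomputable def K₀ (p : ℕ) (I : Ideal R) [I.IsMaximal] (B : Set (Irr G)) : Submodule ℤ (G → K) :=
  Submodule.span ℤ (IPrOf p I B)

/-- The set `S` is a `ℤ`-basis of the group `M` of functions. -/
def IsZBasis (S : Set (G → K)) (M : Submodule ℤ (G → K)) : Prop :=
  LinearIndepOn ℤ id S ∧ Submodule.span ℤ S = M

/-- A basic set of Brauer characters of `B`: a `ℤ`-basis of `G₀(B̂)` consisting of genuine Brauer
characters. -/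
def IsBasicSetBrauer (p : ℕ) (I : Ideal R) [I.IsMaximal] (B : Set (Irr G))
    (BS : Set (G → K)) : Prop :=
  IsZBasis BS (G₀ p I B) ∧ ∀ θ ∈ BS, IsBrauerCharacter p I θ

/-- A system of projective atoms of `B`: a `ℤ`-basis of `K₀(B)` such that every genuine projective
character of `B` is a combination of its members with coefficients in `ℕ`. -/
def IsSystemOfProjectiveAtoms (p : ℕ) (I : Ideal R) [I.IsMaximal] (B : Set (Irr G))
    (PA : Set (G → K)) : Prop :=
  IsZBasis PA (K₀ p I B) ∧
    ∀ Ψ ∈ K₀ p I B, IsProjectiveCharacter p I Ψ → Ψ ∈ AddSubmonoid.closure PA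

/-- The usual inner product of class functions. -/
noncomputable def charInner [Fintype G] (f h : G → K) : ℂ :=
  (Fintype.card G : ℂ)⁻¹ * ∑ g : G, (f g : ℂ) * (starRingEnd ℂ) (h g : ℂ)

/-- `PA` is a `ℤ`-basis of `K₀(B)` dual to `BS` with respect to the inner product. -/
def IsDualBasis [Fintype G] (p : ℕ) (I : Ideal R) [I.IsMaximal] (B : Set (Irr G))
    (BS PA : Set (G → K)) : Prop :=
  IsZBasis PA (K₀ p I B) ∧
    ∃ e : BS ≃ PA, (∀ θ : BS, charInner (e θ).1 θ.1 = 1) ∧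
      ∀ θ η : BS, θ ≠ η → charInner (e θ).1 η.1 = 0

end

end BrauerAtoms

namespace BrauerAtoms

open Module Representation
open scoped MonoidAlgebra

/-! ### Representations over a field: traces, density, class functions. -/

section General

variable {k G V W : Type*} [Field k] [Group G] [AddCommGroup V] [Module k V]
  [AddCommGroup W] [Module k W]

/-! Everything rests on the duality ⟨Φ_φ, ψ⟩ = δ_{φψ} for φ, ψ ∈ IBr(G) (`charInner_PIM`). Expand ψ
as a class function, ψ = ∑ c_χ χ. Since ψ vanishes on p-singular elements, each χ may be replaced by
χ̂ = ∑ d_{χφ} φ. Linear independence of IBr(G) over K (`linearIndepOn_IBr`) then forces ∑_χ c_χ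
d_{χφ} = δ_{φψ}, and this sum is ⟨ψ, Φ_φ⟩. That χ̂ is an ℕ-combination of IBr(G) comes from reducing
an integral model of χ (`hat_character_mem_closure`).

Hence K₀(B) and G₀(B̂) are ℤ-dual lattices, and a basis BS of the latter has exactly one dual basis
in the former. The coordinates of Ψ ∈ K₀(B) in that dual basis are the pairings of Ψ with the
members of BS. A projective character pairs with a Brauer character to a non-negative integer, so
the dual basis consists of projective atoms.

Conversely, let PA be a system of projective atoms and Φ ∈ PA a genuine projective character. Then Φ
is a PIM of B plus a sum of PIMs of B, and both summands lie in the monoid generated by PA. A basis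
element is an atom of that monoid, so the second summand is zero. -/

theorem exists_equiv_fin [FiniteDimensional k V] (ρ : Representation k G V) :
    ∃ X : Representation k G (Fin (finrank k V) → k), Nonempty (ρ.Equiv X) := by
  let e : V ≃ₗ[k] (Fin (finrank k V) → k) := (finBasis k V).equivFun
  refine ⟨(e.conjAlgEquiv k : End k V →* End k (Fin (finrank k V) → k)).comp ρ,
    ⟨Representation.Equiv.mk e fun g => ?_⟩⟩
  ext v
  simp

theorem isIrreducible_of_equiv {ρ : Representation k G V} {σ : Representation k G W}
    (e : ρ.Equiv σ) (h : ρ.IsIrreducible) : σ.IsIrreducible := by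
  rw [irreducible_iff_isSimpleModule_asModule] at h ⊢
  let f : ρ.asModule →ₗ[k[G]] σ.asModule :=
    IntertwiningMap.equivLinearMapAsModule ρ σ e.toIntertwiningMap
  have hf : Function.Bijective f := e.toLinearEquiv.bijective
  exact IsSimpleModule.congr (LinearEquiv.ofBijective f hf).symm

theorem charpoly_eq_of_equiv [FiniteDimensional k V] [FiniteDimensional k W]
    {ρ : Representation k G V} {σ : Representation k G W}
    (e : ρ.Equiv σ) (g : G) : (σ g).charpoly = (ρ g).charpoly := by
  rw [← LinearEquiv.charpoly_conj e.toLinearEquiv (ρ g)]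
  congr 1
  exact (e.conj_apply_self g).symm

theorem charpoly_apply_conj [FiniteDimensional k V] (ρ : Representation k G V) (g h : G) :
    (ρ (h * g * h⁻¹)).charpoly = (ρ g).charpoly := by
  let e : V ≃ₗ[k] V := LinearEquiv.ofLinearMap (ρ h) (ρ h⁻¹)
    (by rw [← End.mul_eq_comp, ← map_mul, mul_inv_cancel, map_one]; rfl)
    (by rw [← End.mul_eq_comp, ← map_mul, inv_mul_cancel, map_one]; rfl)
  rw [← LinearEquiv.charpoly_conj e (ρ g), map_mul, map_mul]
  rfl

/-- Over an infinite field it suffices to compare values at each t, where the claim is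
multiplicativity of det(t - f) along N and V/N. -/
theorem charpoly_eq_mul_of_le_comap [Infinite k] [FiniteDimensional k V] (f : V →ₗ[k] V)
    (N : Submodule k V) (hN : N ≤ N.comap f) :
    f.charpoly = (f.restrict hN).charpoly * (N.mapQ N f hN).charpoly := by
  refine Polynomial.funext fun t => ?_
  rw [Polynomial.eval_mul, LinearMap.eval_charpoly, LinearMap.eval_charpoly,
    LinearMap.eval_charpoly]
  have h : N ≤ N.comap (algebraMap k (End k V) t - f) := fun x hx => by
    simpa using N.sub_mem (N.smul_mem t hx) (hN hx)
  rw [LinearMap.det_eq_det_mul_det N _ h]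
  congr 2
  ext x
  simp

/-- A consequence of the density theorem: over an algebraically closed field, every endomorphism
of one member of a finite family of pairwise non-isomorphic simple modules is induced by an element
that annihilates the other members. -/
theorem exists_smul_eq_and_smul_eq_zero [IsAlgClosed k] {A : Type*} [Ring A] [Algebra k A]
    {ι : Type*} [Finite ι] {S : ι → Type*} [∀ i, AddCommGroup (S i)] [∀ i, Module k (S i)]
    [∀ i, Module A (S i)] [∀ i, IsScalarTower k A (S i)] [∀ i, FiniteDimensional k (S i)]
    [∀ i, IsSimpleModule A (S i)] (hne : ∀ i j, i ≠ j → IsEmpty (S i ≃ₗ[A] S j))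
    (i : ι) (T : End k (S i)) :
    ∃ r : A, (∀ x : S i, r • x = T x) ∧ ∀ j, j ≠ i → ∀ x : S j, r • x = 0 := by
  classical
  have := Fintype.ofFinite ι
  -- By Schur, an A-endomorphism of the product acts on each factor by a scalar. Hence "T on factor
  -- i, zero elsewhere" commutes with all of them and the density theorem applies to it.
  have hscal : ∀ (h : End A (∀ i, S i)) (j : ι), ∃ a : k, ∀ m, h m j = a • m j := by
    intro h j
    let q (l : ι) : S l →ₗ[A] S j := LinearMap.proj j ∘ₗ h ∘ₗ LinearMap.single A S l
    obtain ⟨a, ha⟩ := (IsSimpleModule.algebraMap_end_bijective_of_isAlgClosed (A := A)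
      (V := S j) k).2 (q j)
    have hq : ∀ l, l ≠ j → q l = 0 := fun l hl =>
      (LinearMap.bijective_or_eq_zero (q l)).resolve_left fun hb =>
        (hne l j hl).false (LinearEquiv.ofBijective (q l) hb)
    refine ⟨a, fun m => ?_⟩
    have hm : m = ∑ l, LinearMap.single A S l (m l) := by
      simp [LinearMap.single_apply, Finset.univ_sum_single]
    have h1 : h m j = ∑ l, q l (m l) := by
      conv_lhs => rw [hm, map_sum, Finset.sum_apply]
      rfl
    rw [h1, Finset.sum_eq_single j (fun l _ hl => by rw [hq l hl]; rfl) (by simp), ← ha]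
    rfl
  let f : End (End A (∀ i, S i)) (∀ i, S i) :=
    { toFun := fun m => Pi.single i (T (m i))
      map_add' := fun x y => by simp [Pi.single_add]
      map_smul' := fun h m => by
        obtain ⟨a, ha⟩ := hscal h i
        ext j
        obtain ⟨b, hb⟩ := hscal h j
        rw [RingHom.id_apply, End.smul_def, End.smul_def, hb]
        by_cases hj : j = i
        · subst hj
          simp [hb]
        · simp [hj] }
  -- Density gives agreement only on a finite set; k-bases of the factors are enough.
  let s : Finset (∀ i, S i) := Finset.univ.biUnion fun j =>
    Finset.univ.image fun l => Pi.single j (finBasis k (S j) l)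
  obtain ⟨r, hr⟩ := jacobson_density f s
  have key : ∀ j l, r • finBasis k (S j) l =
      (Pi.single i (T (Pi.single (M := S) j (finBasis k (S j) l) i)) : ∀ i, S i) j := by
    intro j l
    have hmem : Pi.single j (finBasis k (S j) l) ∈ s :=
      Finset.mem_biUnion.mpr ⟨j, Finset.mem_univ _, Finset.mem_image_of_mem _ (Finset.mem_univ l)⟩
    have h1 := congrFun (hr _ hmem) j
    rw [Pi.smul_apply, Pi.single_eq_same] at h1
    exact h1.symm
  refine ⟨r, fun x => ?_, fun j hj x => ?_⟩
  · have : Algebra.lsmul k k (S i) r = T := (finBasis k (S i)).ext fun l => by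
      simpa using key i l
    exact LinearMap.congr_fun this x
  · have : Algebra.lsmul k k (S j) r = 0 := (finBasis k (S j)).ext fun l => by
      simpa [hj] using key j l
    exact LinearMap.congr_fun this x

/-- Traces of pairwise inequivalent irreducible representations over an algebraically closed
field are linearly independent. -/
theorem linearIndependent_character [IsAlgClosed k] {ι : Type*} [Finite ι] {V : ι → Type*}
    [∀ i, AddCommGroup (V i)] [∀ i, Module k (V i)] [∀ i, FiniteDimensional k (V i)]
    (X : ∀ i, Representation k G (V i)) (hX : ∀ i, (X i).IsIrreducible)
    (hne : ∀ i j, i ≠ j → IsEmpty ((X i).Equiv (X j))) :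
    LinearIndependent k fun i => (X i).character := by
  classical
  have := Fintype.ofFinite ι
  rw [Fintype.linearIndependent_iff]
  intro c hc i
  have : ∀ i, FiniteDimensional k (X i).asModule := fun i => inferInstanceAs (FiniteDimensional k (V i))
  have hne' : ∀ i j, i ≠ j → IsEmpty ((X i).asModule ≃ₗ[k[G]] (X j).asModule) := fun i j hij =>
    ⟨fun e => (hne i j hij).false <|
      ((IntertwiningMap.equivLinearMapAsModule (X i) (X j)).symm e.toLinearMap).ofBijective
        e.bijective⟩
  have hnt : Nontrivial (V i) := IsSimpleModule.nontrivial k[G] (X i).asModule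
  obtain ⟨v, hv⟩ := exists_ne (0 : V i)
  obtain ⟨φ, hφ⟩ : ∃ φ : Dual k (V i), φ v = 1 := by
    obtain ⟨ψ, hψ⟩ := not_forall.mp ((forall_dual_apply_eq_zero_iff k v).not.mpr hv)
    exact ⟨(ψ v)⁻¹ • ψ, by simp [hψ]⟩
  -- A rank-one projection: its trace is 1 in every characteristic, whereas the trace of the
  -- identity may vanish.
  let T : End k (V i) := φ.smulRight v
  have hT : LinearMap.trace k _ T = 1 := by simp [T, hφ]
  obtain ⟨r, hr, hr0⟩ := exists_smul_eq_and_smul_eq_zero (k := k) (A := k[G]) hne' i T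
  have hri : (X i).asAlgebraHom r = T := LinearMap.ext hr
  have hrj : ∀ j, j ≠ i → (X j).asAlgebraHom r = 0 := fun j hj => LinearMap.ext (hr0 j hj)
  have hlin : ∑ j, c j • (LinearMap.trace k (V j) ∘ₗ (X j).asAlgebraHom.toLinearMap) = 0 := by
    ext g
    simpa [character] using congrFun hc g
  have h1 := LinearMap.congr_fun hlin r
  simp only [LinearMap.sum_apply, LinearMap.smul_apply, LinearMap.comp_apply,
    AlgHom.toLinearMap_apply, LinearMap.zero_apply] at h1
  rw [Finset.sum_eq_single i (fun j _ hj => by rw [hrj j hj]; simp) (by simp), hri, hT] at h1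
  simpa using h1

/-- The operator commutes with ρ because f is a class function, so it is a scalar by Schur. Its
trace is zero, and the degree is invertible in characteristic zero. -/
theorem sum_smul_apply_inv_eq_zero [IsAlgClosed k] [CharZero k] [Fintype G]
    [FiniteDimensional k V] (ρ : Representation k G V) (hρ : ρ.IsIrreducible)
    (f : G → k) (hf : ∀ g h, f (h * g * h⁻¹) = f g) (h0 : ∑ g, f g * ρ.character g⁻¹ = 0) :
    ∑ g, f g • ρ g⁻¹ = 0 := by
  let q : ρ.IntertwiningMap ρ :=
    { toLinearMap := ∑ g, f g • ρ g⁻¹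
      isIntertwining' := fun h => by
        change (∑ g, f g • ρ g⁻¹) * ρ h = ρ h * ∑ g, f g • ρ g⁻¹
        rw [Finset.sum_mul, Finset.mul_sum]
        refine Fintype.sum_equiv (MulAut.conj h⁻¹).toEquiv _ _ fun g => ?_
        have : f (h⁻¹ * g * h) = f g := by simpa using hf g h⁻¹
        simp [← map_mul, mul_assoc, ← this] }
  obtain ⟨a, ha⟩ := (IsIrreducible.algebraMap_intertwiningMap_bijective_of_isAlgClosed
    (ρ := ρ)).2 q
  have hqa : ∑ g, f g • ρ g⁻¹ = algebraMap k (End k V) a :=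
    (congrArg IntertwiningMap.toLinearMap ha).symm
  have htr : LinearMap.trace k _ (∑ g, f g • ρ g⁻¹) = 0 := by
    rw [map_sum]
    simpa [character] using h0
  rw [hqa, Algebra.algebraMap_eq_smul_one, map_smul, LinearMap.trace_one] at htr
  have : Nontrivial V := IsSimpleModule.nontrivial k[G] ρ.asModule
  have hn : (finrank k V : k) ≠ 0 := by
    exact_mod_cast (finrank_pos (R := k) (M := V)).ne'
  have ha0 : a = 0 := (mul_eq_zero.mp htr).resolve_right hn
  rw [hqa, ha0, map_zero]

theorem asAlgebraHom_ofModule' {M : Type*} [AddCommGroup M] [Module k M] [Module k[G] M]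
    [IsScalarTower k k[G] M] : (ofModule' (k := k) (G := G) M).asAlgebraHom = Algebra.lsmul k k M :=
  (MonoidAlgebra.lift k (M →ₗ[k] M) G).apply_symm_apply _

theorem isIrreducible_ofModule' {M : Type*} [AddCommGroup M] [Module k M] [Module k[G] M]
    [IsScalarTower k k[G] M] [IsSimpleModule k[G] M] :
    (ofModule' (k := k) (G := G) M).IsIrreducible := by
  rw [irreducible_iff_isSimpleModule_asModule]
  let e : (ofModule' (k := k) (G := G) M).asModule ≃ₗ[k[G]] M :=
    { (ofModule' (k := k) (G := G) M).asModuleEquiv.toAddEquiv with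
      map_smul' := fun r x => LinearMap.congr_fun
        (AlgHom.congr_fun (asAlgebraHom_ofModule' (k := k) (G := G) (M := M)) r) (show M from x) }
  exact IsSimpleModule.congr e

theorem sum_single_smul_eq_zero [IsAlgClosed k] [CharZero k] [Fintype G]
    {M : Type*} [AddCommGroup M] [Module k M] [Module k[G] M] [IsScalarTower k k[G] M]
    [IsSimpleModule k[G] M]
    (f : G → k) (hf : ∀ g h, f (h * g * h⁻¹) = f g)
    (h0 : ∀ (n : ℕ) (X : Representation k G (Fin n → k)), X.IsIrreducible →
      ∑ g, f g * X.character g⁻¹ = 0) (x : M) :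
    (∑ g, MonoidAlgebra.single g⁻¹ (f g) : k[G]) • x = 0 := by
  have hρ := isIrreducible_ofModule' (k := k) (G := G) (M := M)
  have : FiniteDimensional k M := Module.Finite.trans k[G] _
  obtain ⟨X, ⟨e⟩⟩ := exists_equiv_fin (ofModule' (k := k) (G := G) M)
  have h1 := sum_smul_apply_inv_eq_zero _ hρ f hf <| by
    rw [char_iso e]
    exact h0 _ X (isIrreducible_of_equiv e hρ)
  have h2 : (ofModule' (k := k) (G := G) M).asAlgebraHom
      (∑ g, MonoidAlgebra.single g⁻¹ (f g)) = 0 := by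
    simpa [asAlgebraHom_single] using h1
  rw [asAlgebraHom_ofModule'] at h2
  exact LinearMap.congr_fun h2 x

/-- A function that is constant on conjugacy classes and orthogonal to all irreducible
characters vanishes. -/
theorem eq_zero_of_forall_sum_mul_character_eq_zero [IsAlgClosed k] [CharZero k] [Fintype G]
    (f : G → k) (hf : ∀ g h, f (h * g * h⁻¹) = f g)
    (h0 : ∀ (n : ℕ) (X : Representation k G (Fin n → k)), X.IsIrreducible →
      ∑ g, f g * X.character g⁻¹ = 0) : f = 0 := by
  let z : k[G] := ∑ g, MonoidAlgebra.single g⁻¹ (f g)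
  have hsimple : ∀ N : Submodule k[G] k[G], IsSimpleModule k[G] N → ∀ x ∈ N, z * x = 0 := by
    intro N hN x hx
    simpa [Subtype.ext_iff, z, sum_single_smul_eq_zero] using
      sum_single_smul_eq_zero (M := N) f hf h0 ⟨x, hx⟩
  -- By Maschke the group algebra is the sum of its simple left ideals, all killed by z; hence z = z
  -- * 1 = 0.
  have hz0 : z = 0 := by
    have : NeZero (Nat.card G : k) := ⟨by exact_mod_cast Nat.card_pos.ne'⟩
    have htop := IsSemisimpleModule.sSup_simples_eq_top k[G] k[G]
    have h1 : (1 : k[G]) ∈ sSup {N : Submodule k[G] k[G] | IsSimpleModule k[G] N} :=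
      htop ▸ Submodule.mem_top
    rw [sSup_eq_iSup'] at h1
    have : z * 1 = 0 := Submodule.iSup_induction _ (motive := fun x => z * x = 0) h1
      (fun N x hx => hsimple N.1 N.2 x hx) (mul_zero z)
      fun x y hx hy => by rw [mul_add, hx, hy, add_zero]
    simpa using this
  ext g
  have := congrArg (fun w : k[G] => w.coeff g⁻¹) hz0
  classical
  simpa [z, Finsupp.single_apply] using this

/-- In characteristic p, (ρ u - 1)^(p^a) = ρ u^(p^a) - 1 = 0. So ρ (u * r) - ρ r = (ρ u - 1) ρ r is
a product of commuting operators, one of them nilpotent, and has trace zero. -/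
theorem trace_apply_eq_of_commute {p : ℕ} [CharP k p] [Fact p.Prime] [FiniteDimensional k V]
    (ρ : Representation k G V) {u r : G} (hur : Commute u r) {a : ℕ} (hu : u ^ p ^ a = 1) :
    ρ.character (u * r) = ρ.character r := by
  cases subsingleton_or_nontrivial V
  · simp [character, Subsingleton.elim _ (0 : End k V)]
  have : CharP (End k V) p := charP_of_injective_algebraMap' k p
  have hnil : IsNilpotent (ρ (u * r) - ρ r) := by
    have h1 : IsNilpotent (ρ u - 1) := by
      refine ⟨p ^ a, ?_⟩
      rw [sub_pow_char_pow_of_commute _ _ (Commute.one_right _), ← map_pow, hu, map_one, one_pow,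
        sub_self]
    have h2 : Commute (ρ u - 1) (ρ r) := (hur.map ρ).sub_left (Commute.one_left _)
    rw [map_mul, ← sub_one_mul]
    exact h2.isNilpotent_mul_right h1
  have := (LinearMap.isNilpotent_trace_of_isNilpotent hnil).eq_zero
  rwa [map_sub, sub_eq_zero] at this

open ComplexOrder Matrix in
-- Averaging gives an invariant positive definite form H, for which the adjoint of M g is conjugate
-- to M g⁻¹.
theorem conj_trace_eq_trace_inv [Finite G] {n : Type*} [Fintype n] [DecidableEq n]
    (M : G →* Matrix n n ℂ) (g : G) : (starRingEnd ℂ) (M g).trace = (M g⁻¹).trace := by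
  classical
  have := Fintype.ofFinite G
  obtain ⟨H, hH⟩ : ∃ H : Matrix n n ℂ, H = ∑ h, (M h)ᴴ * M h := ⟨_, rfl⟩
  have hpos : H.PosDef := by
    rw [hH, ← Finset.add_sum_erase _ _ (Finset.mem_univ 1), map_one, conjTranspose_one, one_mul]
    exact PosDef.one.add_posSemidef
      (posSemidef_sum _ fun h _ => posSemidef_conjTranspose_mul_self (M h))
  have hcomm : (M g)ᴴ * H = H * M g⁻¹ := by
    rw [hH, Finset.mul_sum, Finset.sum_mul]
    refine Fintype.sum_equiv (Equiv.mulRight g) _ _ fun h => ?_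
    rw [Equiv.coe_mulRight, mul_assoc (M (h * g))ᴴ, ← map_mul, mul_inv_cancel_right, map_mul,
      conjTranspose_mul, mul_assoc]
  have hdet := (isUnit_iff_isUnit_det _).mp hpos.isUnit
  have h1 : (M g)ᴴ = H * M g⁻¹ * H⁻¹ := by
    rw [← hcomm, mul_assoc, mul_nonsing_inv _ hdet, mul_one]
  rw [starRingEnd_apply, ← trace_conjTranspose, h1, trace_mul_comm, ← mul_assoc,
    nonsing_inv_mul _ hdet, one_mul]

end General

end BrauerAtoms

namespace BrauerAtoms

open Module Representation

/-! ### Reduction modulo I through a valuation ring of K. -/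

section Reduction

/-- The localization at P is dominated by a valuation ring. -/
theorem exists_valuationSubring_of_isPrime {L : Type*} [Field L] (A : Subring L) (P : Ideal A)
    [P.IsPrime] : ∃ (V : ValuationSubring L) (h : A ≤ V.toSubring),
      ∀ x ∈ P, Subring.inclusion h x ∈ IsLocalRing.maximalIdeal V := by
  obtain ⟨V, hV⟩ := LocalSubring.exists_le_valuationSubring (LocalSubring.ofPrime A P)
  refine ⟨V, (LocalSubring.le_ofPrime A P).trans hV.1, fun x hx => ?_⟩
  have h1 : algebraMap A (LocalSubring.ofPrime A P).toSubring x ∈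
      IsLocalRing.maximalIdeal (LocalSubring.ofPrime A P).toSubring :=
    (IsLocalization.AtPrime.to_map_mem_maximal_iff _ P x).mpr hx
  have h2 := ((IsLocalRing.local_hom_TFAE (Subring.inclusion hV.1)).out 0 1).mp hV.2
  exact h2 ⟨_, h1, rfl⟩

instance : IsAlgClosed K := (algebraicClosure.isAlgClosure ℚ ℂ).isAlgClosed

/-- A monic polynomial lifts to a monic one over R; a root of the lift in K is integral over R,
hence over ℤ, and can be reduced. -/
instance (I : Ideal R) [I.IsMaximal] : IsAlgClosed (F I) := by
  refine IsAlgClosed.of_exists_root _ fun f hf hirr => ?_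
  obtain ⟨q, hq, hdeg, hmon⟩ := Polynomial.lifts_and_natDegree_eq_and_monic
    (f := Ideal.Quotient.mk I) (p := f)
    ((Polynomial.mem_lifts _).mpr (Polynomial.map_surjective _ Ideal.Quotient.mk_surjective f)) hf
  have hd : (q.map (algebraMap R K)).degree ≠ 0 := by
    rw [hmon.degree_map, Polynomial.degree_eq_natDegree hmon.ne_zero, hdeg,
      ← Polynomial.degree_eq_natDegree hf.ne_zero]
    exact (Polynomial.degree_pos_of_irreducible hirr).ne'
  obtain ⟨z, hz⟩ := IsAlgClosed.exists_root _ hd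
  rw [Polynomial.IsRoot, Polynomial.eval_map] at hz
  have hzR : IsIntegral R z := ⟨q, hmon, hz⟩
  have hzZ : IsIntegral ℤ z := isIntegral_trans z hzR
  refine ⟨Ideal.Quotient.mk I ⟨z, hzZ⟩, ?_⟩
  have : q.eval (⟨z, hzZ⟩ : R) = 0 := by
    refine Subtype.val_injective ?_
    exact (Polynomial.eval₂_at_apply (algebraMap R K) (⟨z, hzZ⟩ : R)).symm.trans hz
  rw [← hq, Polynomial.eval_map, Polynomial.eval₂_at_apply, this, map_zero]

theorem charP_F {p : ℕ} (hp : p.Prime) (I : Ideal R) [I.IsMaximal] (hpI : (p : R) ∈ I) :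
    CharP (F I) p := by
  refine (CharP.charP_iff_prime_eq_zero hp).mpr ?_
  simpa using Ideal.Quotient.eq_zero_iff_mem.mpr hpI

/-- The reduction map `R → F` extends to a valuation ring of `K`. -/
theorem exists_valuationSubring_hom {p : ℕ} (hp : p.Prime) (I : Ideal R) [I.IsMaximal]
    (hpI : (p : R) ∈ I) :
    ∃ (V : ValuationSubring K) (h : ∀ x : R, (x : K) ∈ V) (π : V →+* F I),
      ∀ x : R, π ⟨x, h x⟩ = Ideal.Quotient.mk I x := by
  let J : Ideal R.toSubring := I
  have hJ : J.IsPrime := inferInstanceAs I.IsPrime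
  obtain ⟨V, hV, hmax⟩ := exists_valuationSubring_of_isPrime R.toSubring J
  have h : ∀ x : R, (x : K) ∈ V := fun x => hV x.2
  let ι : R →+* V := Subring.inclusion hV
  let j : F I →+* IsLocalRing.ResidueField V :=
    Ideal.Quotient.lift I ((IsLocalRing.residue V).comp ι) fun x hx =>
      (IsLocalRing.residue_eq_zero_iff _).mpr (hmax x hx)
  algebraize [j]
  -- An element of V is a root of a primitive integer polynomial, which stays nonzero modulo p. So
  -- the residue field is algebraic over the algebraically closed F, and `j` is bijective.
  have hint : Algebra.IsIntegral (F I) (IsLocalRing.ResidueField V) := by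
    refine ⟨fun y => IsAlgebraic.isIntegral ?_⟩
    obtain ⟨v, rfl⟩ := IsLocalRing.residue_surjective y
    have hv : IsAlgebraic ℤ (v : K) :=
      (IsFractionRing.isAlgebraic_iff ℤ ℚ K).mpr ((algebraicClosure.isAlgebraic ℚ ℂ).isAlgebraic _)
    obtain ⟨P, hP, hPv⟩ := hv
    have hPv' := Polynomial.aeval_primPart_eq_zero hP hPv
    refine ⟨P.primPart.map (Int.castRingHom (F I)), fun h0 => ?_, ?_⟩
    · have hdvd : Polynomial.C (p : ℤ) ∣ P.primPart := by
        rw [Polynomial.C_dvd_iff_dvd_coeff]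
        intro i
        have := congrArg (fun f => f.coeff i) h0
        simp only [Polynomial.coeff_map, Polynomial.coeff_zero, eq_intCast] at this
        have := charP_F hp I hpI
        exact (CharP.intCast_eq_zero_iff (F I) p _).mp ‹_›
      have := P.isPrimitive_primPart _ hdvd
      exact hp.one_lt.ne' (by simpa using Int.isUnit_iff_natAbs_eq.mp this)
    · have h1 : Polynomial.aeval v P.primPart = 0 := by
        refine Subtype.val_injective ?_
        exact (Polynomial.aeval_algHom_apply (V.subtype.toIntAlgHom) v P.primPart).symm.trans hPv'
      rw [Polynomial.aeval_def, Polynomial.eval₂_map,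
        RingHom.ext_int ((algebraMap (F I) _).comp _)
          ((IsLocalRing.residue V).comp (algebraMap ℤ V)), ← Polynomial.hom_eval₂,
        ← Polynomial.aeval_def, h1, map_zero]
  have hbij := IsAlgClosed.algebraMap_bijective_of_isIntegral (k := F I)
    (K := IsLocalRing.ResidueField V)
  let e : F I ≃+* IsLocalRing.ResidueField V := RingEquiv.ofBijective j hbij
  refine ⟨V, h, e.symm.toRingHom.comp (IsLocalRing.residue V), fun x => ?_⟩
  exact (RingEquiv.symm_apply_eq e).mpr rfl

/-- A representation over the fraction field of a valuation ring can be written over the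
valuation ring. -/
theorem exists_integral_model {L : Type*} [Field L] (V : ValuationSubring L) {G : Type*} [Group G]
    [Finite G] {n : ℕ} (X : Representation L G (Fin n → L)) :
    ∃ (m : ℕ) (M : G →* Matrix (Fin m) (Fin m) V),
      ∀ g, (X g).charpoly = (M g).charpoly.map (algebraMap V L) := by
  -- The translates of the standard basis span a G-stable finitely generated V-lattice; being
  -- torsion-free over a valuation ring, it is flat and hence free.
  let S : Set (Fin n → L) := Set.range fun q : G × Fin n => X q.1 (Pi.single q.2 1)
  let N : Submodule V (Fin n → L) := Submodule.span V S
  have hfin : Module.Finite V N := Module.Finite.span_of_finite V (Set.finite_range _)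
  have hflat : Module.Flat V N := by
    rw [Module.Flat.flat_iff_torsion_eq_bot_of_isBezout, ← Submodule.isTorsionFree_iff_torsion_eq_bot]
    infer_instance
  have hfree : Module.Free V N := Module.free_of_flat_of_isLocalRing
  let b := Module.finBasis V N
  have hN : ∀ g, ∀ x ∈ N, X g x ∈ N := by
    intro g x hx
    induction hx using Submodule.span_induction with
    | mem x hx =>
      obtain ⟨⟨h, i⟩, rfl⟩ := hx
      refine Submodule.subset_span ⟨(g * h, i), ?_⟩
      simp
    | zero => simp
    | add x y _ _ hx hy => rw [map_add]; exact N.add_mem hx hy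
    | smul a x _ hx =>
      have : X g (a • x) = a • X g x := (X g).map_smul (a : L) x
      exact this ▸ N.smul_mem a hx
  let ρ : G →* Module.End V N := 
    { toFun := fun g => ((X g).restrictScalars V).restrict (hN g)
      map_one' := by ext; simp
      map_mul' := fun g h => LinearMap.ext fun x => Subtype.ext <|
        LinearMap.congr_fun (X.map_mul g h) x }
  have hli : LinearIndependent L fun i => (b i : Fin n → L) :=
    (LinearIndependent.iff_fractionRing V L).mp
      (b.linearIndependent.map' N.subtype (Submodule.ker_subtype N))
  have hsum : ∀ x : N, (x : Fin n → L) = ∑ i, (b.repr x i : L) • (b i : Fin n → L) := by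
    intro x
    conv_lhs => rw [← b.sum_repr x]
    rw [AddSubmonoidClass.coe_finsetSum]
    rfl
  have hspan : ⊤ ≤ Submodule.span L (Set.range fun i => (b i : Fin n → L)) := by
    rw [← (Pi.basisFun L (Fin n)).span_eq, Submodule.span_le]
    rintro _ ⟨i, rfl⟩
    have hi : Pi.basisFun L (Fin n) i ∈ N := Submodule.subset_span ⟨(1, i), by simp⟩
    rw [show Pi.basisFun L (Fin n) i = ((⟨_, hi⟩ : N) : Fin n → L) from rfl, hsum]
    exact Submodule.sum_mem _ fun j _ =>
      Submodule.smul_mem _ _ (Submodule.subset_span (Set.mem_range_self j))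
  let b' : Basis (Fin (finrank V N)) L (Fin n → L) := Basis.mk hli hspan
  have hb' : ∀ i, b' i = b i := fun i => Basis.mk_apply hli hspan i
  refine ⟨finrank V N, (LinearMap.toMatrixAlgEquiv b : _ →* _).comp ρ, fun g => ?_⟩
  rw [← LinearMap.charpoly_toMatrix (X g) b', ← Matrix.charpoly_map]
  congr 1
  ext i j
  have h1 : X g (b' j) = ∑ i, (b.repr (ρ g (b j)) i : L) • b' i := by
    simp_rw [hb']
    exact hsum (ρ g (b j))
  rw [LinearMap.toMatrix_apply, h1, b'.repr_sum_self]
  exact congrArg Subtype.val (LinearMap.toMatrixAlgEquiv_apply b (ρ g) i j).symm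

end Reduction

end BrauerAtoms

namespace BrauerAtoms

open Module Representation

/-! ### Brauer characters and their linear independence. -/

section Brauer

variable {G : Type*} [Group G] {p : ℕ} {I : Ideal R} [I.IsMaximal]

theorem pow_eq_one_of_mem_roots_charpoly {k V : Type*} [Field k] [AddCommGroup V] [Module k V]
    [FiniteDimensional k V] {f : End k V} {m : ℕ} (hf : f ^ m = 1) {ζ : k}
    (hζ : ζ ∈ f.charpoly.roots) : ζ ^ m = 1 := by
  have h1 : f.HasEigenvalue ζ :=
    (Module.End.hasEigenvalue_iff_isRoot_charpoly f ζ).mpr (Polynomial.isRoot_of_mem_roots hζ)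
  obtain ⟨v, hv⟩ := h1.exists_hasEigenvector
  have h2 := hv.pow_apply m
  rw [hf, End.one_apply] at h2
  exact (smul_left_injective k hv.2 (h2.symm.trans (one_smul k v).symm))

theorem not_dvd_pPrimePart [Finite G] (hp : p.Prime) : ¬ p ∣ pPrimePart p G :=
  Nat.not_dvd_ordCompl hp Nat.card_pos.ne'

theorem orderOf_dvd_pPrimePart [Finite G] (hp : p.Prime) {g : G} (hg : ¬ p ∣ orderOf g) :
    orderOf g ∣ pPrimePart p G := by
  have h1 : orderOf g ∣ ordProj[p] (Nat.card G) * ordCompl[p] (Nat.card G) := by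
    rw [Nat.ordProj_mul_ordCompl_eq_self]
    exact orderOf_dvd_natCard g
  exact (((Nat.Prime.coprime_iff_not_dvd hp).mpr hg).symm.pow_right _).dvd_of_dvd_mul_left h1

theorem apply_pow_pPrimePart [Finite G] (hp : p.Prime) {k V : Type*} [Field k] [AddCommGroup V]
    [Module k V] (X : Representation k G V) {g : G} (hg : ¬ p ∣ orderOf g) :
    X g ^ pPrimePart p G = 1 := by
  rw [← map_pow, orderOf_dvd_iff_pow_eq_one.mp (orderOf_dvd_pPrimePart hp hg), map_one]

theorem rootLift_mk (hp : p.Prime) (hpI : (p : R) ∈ I) {m : ℕ} (hm : ¬ p ∣ m) {z : R}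
    (hz : z ^ m = 1) : rootLift I m (Ideal.Quotient.mk I z) = z := by
  have h : ∃ w : R, w ^ m = 1 ∧ Ideal.Quotient.mk I w = Ideal.Quotient.mk I z := ⟨z, hz, rfl⟩
  rw [rootLift, dif_pos h]
  congr 1
  exact (existsUnique_rootOfUnity_lift hp I hpI hm (Ideal.Quotient.mk I z)
    (by rw [← map_pow, hz, map_one])).unique h.choose_spec ⟨hz, rfl⟩

theorem brauerCharacter_of_dvd {n : ℕ} (X : Representation (F I) G (Fin n → F I)) {g : G}
    (hg : p ∣ orderOf g) : brauerCharacter p I X g = 0 := if_pos hg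

theorem brauerCharacter_of_not_dvd {n : ℕ} (X : Representation (F I) G (Fin n → F I)) {g : G}
    (hg : ¬ p ∣ orderOf g) : brauerCharacter p I X g =
      ((X g).charpoly.roots.map (rootLift I (pPrimePart p G))).sum := if_neg hg

theorem brauerCharacter_conj {n : ℕ} (X : Representation (F I) G (Fin n → F I)) (g h : G) :
    brauerCharacter p I X (h * g * h⁻¹) = brauerCharacter p I X g := by
  have h1 : orderOf (h * g * h⁻¹) = orderOf g := (MulAut.conj h).orderOf_eq g
  simp only [brauerCharacter, h1, charpoly_apply_conj]

theorem brauerCharacter_eq_of_charpoly_eq {n n' : ℕ} {X : Representation (F I) G (Fin n → F I)}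
    {Y : Representation (F I) G (Fin n' → F I)} (h : ∀ g, (X g).charpoly = (Y g).charpoly) :
    brauerCharacter p I X = brauerCharacter p I Y := by
  funext g
  simp only [brauerCharacter, h]

theorem brauerCharacter_eq_add {n n₁ n₂ : ℕ} {X : Representation (F I) G (Fin n → F I)}
    {Y : Representation (F I) G (Fin n₁ → F I)} {Z : Representation (F I) G (Fin n₂ → F I)}
    (h : ∀ g, (X g).charpoly = (Y g).charpoly * (Z g).charpoly) :
    brauerCharacter p I X = brauerCharacter p I Y + brauerCharacter p I Z := by
  funext g
  by_cases hg : p ∣ orderOf g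
  · simp [brauerCharacter, hg]
  · have h0 := mul_ne_zero (Y g).charpoly_monic.ne_zero (Z g).charpoly_monic.ne_zero
    simp [brauerCharacter, hg, h, Polynomial.roots_mul h0]

theorem exists_mk_eq_and_eq_rootLift (hp : p.Prime) (hpI : (p : R) ∈ I) {m : ℕ} (hm : ¬ p ∣ m)
    {ζ : F I} (hζ : ζ ^ m = 1) : ∃ z : R, (z : K) = rootLift I m ζ ∧ Ideal.Quotient.mk I z = ζ := by
  obtain ⟨z, ⟨hz, rfl⟩, -⟩ := existsUnique_rootOfUnity_lift hp I hpI hm ζ hζ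
  exact ⟨z, (rootLift_mk hp hpI hm hz).symm, rfl⟩

/-- The Brauer character takes values in `R`, and reduces to the trace. -/
theorem exists_brauerCharacter_eq [Finite G] (hp : p.Prime) (hpI : (p : R) ∈ I) {n : ℕ}
    (X : Representation (F I) G (Fin n → F I)) {g : G} (hg : ¬ p ∣ orderOf g) :
    ∃ r : R, (r : K) = brauerCharacter p I X g ∧ Ideal.Quotient.mk I r = X.character g := by
  have h1 : ∀ s : Multiset (F I), (∀ ζ ∈ s, ζ ^ pPrimePart p G = 1) →
      ∃ r : R, (r : K) = (s.map (rootLift I (pPrimePart p G))).sum ∧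
        Ideal.Quotient.mk I r = s.sum := by
    intro s
    induction s using Multiset.induction with
    | empty => exact fun _ => ⟨0, by simp, by simp⟩
    | cons ζ s ih =>
      intro h
      obtain ⟨r, hr, hr'⟩ := ih fun ξ hξ => h ξ (Multiset.mem_cons_of_mem hξ)
      obtain ⟨z, hz, hz'⟩ := exists_mk_eq_and_eq_rootLift hp hpI (not_dvd_pPrimePart hp)
        (h ζ (Multiset.mem_cons_self ζ s))
      exact ⟨z + r, by simp [hz, hr], by simp [hz', hr']⟩
  obtain ⟨r, hr, hr'⟩ := h1 (X g).charpoly.roots fun ζ hζ =>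
    pow_eq_one_of_mem_roots_charpoly (apply_pow_pPrimePart hp X hg) hζ
  refine ⟨r, by rw [hr, brauerCharacter_of_not_dvd X hg], ?_⟩
  rw [hr', character]
  exact (Module.End.trace_eq_sum_roots_charpoly_of_splits (IsAlgClosed.splits _)).symm

/-- Here r is the p-regular part of g, obtained by Bézout from the factorization of its order; the
complementary factor has p-power order and does not affect traces in characteristic p. -/
theorem exists_regular_character_eq [Finite G] (hp : p.Prime) (hpI : (p : R) ∈ I) (g : G) :
    ∃ r : G, ¬ p ∣ orderOf r ∧ ∀ (n : ℕ) (X : Representation (F I) G (Fin n → F I)),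
      X.character g = X.character r := by
  have := Fact.mk hp
  have := charP_F hp I hpI
  have ho : orderOf g ≠ 0 := (orderOf_pos g).ne'
  set a := (orderOf g).factorization p with ha
  set q := ordCompl[p] (orderOf g) with hq
  have hpq : p ^ a * q = orderOf g := Nat.ordProj_mul_ordCompl_eq_self _ _
  have hcop : IsCoprime ((p ^ a : ℕ) : ℤ) (q : ℤ) :=
    Nat.isCoprime_iff_coprime.mpr ((Nat.coprime_ordCompl hp ho).pow_left a)
  obtain ⟨x, y, hxy⟩ := hcop
  have hone : g ^ ((p ^ a : ℕ) * (q : ℤ)) = 1 := by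
    rw [← Nat.cast_mul, hpq, zpow_natCast, pow_orderOf_eq_one]
  have hr : (g ^ (x * (p ^ a : ℕ))) ^ q = 1 := by
    rw [← zpow_natCast, ← zpow_mul, mul_assoc, mul_comm x, zpow_mul, hone, one_zpow]
  have hu : (g ^ (y * q)) ^ p ^ a = 1 := by
    rw [← zpow_natCast, ← zpow_mul, mul_assoc, mul_comm y, mul_comm (q : ℤ), zpow_mul, hone,
      one_zpow]
  refine ⟨g ^ (x * (p ^ a : ℕ)), fun hdvd => Nat.not_dvd_ordCompl hp ho
    (hdvd.trans (orderOf_dvd_of_pow_eq_one hr)), fun n X => ?_⟩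
  have h := trace_apply_eq_of_commute X
    ((Commute.refl g).zpow_zpow (y * q) (x * (p ^ a : ℕ))) hu
  rw [← h, ← zpow_add, add_comm, hxy, zpow_one]

/-- Irreducible Brauer characters are linearly independent over `K`. -/
theorem linearIndepOn_IBr [Finite G] (hp : p.Prime) (hpI : (p : R) ∈ I) :
    LinearIndepOn K id (IBr G p I) := by
  classical
  obtain ⟨V, hRV, π, hπ⟩ := exists_valuationSubring_hom hp I hpI
  choose n X hX hφ using fun φ : IBr G p I => φ.2
  rw [LinearIndepOn, linearIndependent_iff']
  intro s c hc
  by_contra! hne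
  obtain ⟨i₀, hi₀, hci₀⟩ := hne
  -- Dividing a relation by a coefficient of largest valuation puts all coefficients in V, one of
  -- them equal to 1. Its reduction is a nontrivial relation between traces over F.
  obtain ⟨i, hi, hmax⟩ := s.exists_max_image (fun j => V.valuation (c j)) ⟨i₀, hi₀⟩
  have hci : c i ≠ 0 := by
    intro h0
    have := hmax i₀ hi₀
    rw [h0, map_zero, nonpos_iff_eq_zero, Valuation.zero_iff] at this
    exact hci₀ this
  have hmem : ∀ j ∈ s, c j / c i ∈ V := by
    intro j hj
    rw [← V.valuation_le_one_iff, map_div₀]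
    exact div_le_one_of_le₀ (hmax j hj) zero_le
  let a : s → V := fun j => ⟨c j / c i, hmem j j.2⟩
  have hai : a ⟨i, hi⟩ = 1 := Subtype.ext (div_self hci)
  have hli := linearIndependent_character (fun j : s => X j) (fun j => hX j) fun j l hjl =>
    ⟨fun e => hjl <| Subtype.ext <| Subtype.ext <| by
      rw [hφ j, hφ l]
      exact brauerCharacter_eq_of_charpoly_eq fun g => (charpoly_eq_of_equiv e g).symm⟩
  have h0 := Fintype.linearIndependent_iff.mp hli (fun j => π (a j)) (by
    funext g
    obtain ⟨r, hr, hgr⟩ := exists_regular_character_eq (G := G) hp hpI g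
    choose ρ hρ hρ' using fun j : s => exists_brauerCharacter_eq hp hpI (X j) hr
    have h1 : ∑ j : s, a j * ⟨ρ j, hRV (ρ j)⟩ = 0 := by
      apply Subtype.val_injective
      have h2 := congrFun hc r
      rw [← Finset.sum_coe_sort] at h2
      simp only [Finset.sum_apply, Pi.smul_apply, id, smul_eq_mul, Pi.zero_apply] at h2
      have h3 : ∑ j : s, c j / c i * ρ j = 0 := by
        simp_rw [hρ, ← hφ, div_mul_eq_mul_div, ← Finset.sum_div]
        rw [h2, zero_div]
      rw [← ZeroMemClass.coe_zero V] at h3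
      rw [AddSubmonoidClass.coe_finsetSum]
      exact h3
    have h2 := congrArg π h1
    rw [map_sum, map_zero] at h2
    simp only [map_mul, hπ, hρ'] at h2
    simpa [hgr] using h2) ⟨i, hi⟩
  rw [hai, map_one] at h0
  exact one_ne_zero h0

end Brauer

end BrauerAtoms

namespace BrauerAtoms

open Module Representation

/-! ### Decomposition into irreducible Brauer characters. -/

section Brauer

variable {G : Type*} [Group G] {p : ℕ} {I : Ideal R} [I.IsMaximal]

theorem exists_charpoly_eq_mul {k : Type*} [Field k] [Infinite k] {n : ℕ}
    (X : Representation k G (Fin n → k)) (hn : n ≠ 0) (hX : ¬ X.IsIrreducible) :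
    ∃ (n₁ n₂ : ℕ) (Y : Representation k G (Fin n₁ → k)) (Z : Representation k G (Fin n₂ → k)),
      n₁ < n ∧ n₂ < n ∧ ∀ g, (X g).charpoly = (Y g).charpoly * (Z g).charpoly := by
  have : Nonempty (Fin n) := ⟨⟨0, Nat.pos_of_ne_zero hn⟩⟩
  have hnt : Nontrivial (Subrepresentation X) := by
    refine ⟨⊥, ⊤, fun h => ?_⟩
    have : (⊥ : Submodule k (Fin n → k)) = ⊤ := congrArg Subrepresentation.toSubmodule h
    exact bot_ne_top this
  obtain ⟨σ, hσ⟩ : ∃ σ : Subrepresentation X, ¬ (σ = ⊥ ∨ σ = ⊤) := by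
    by_contra! h
    exact hX ⟨h⟩
  rw [not_or] at hσ
  have hbot : σ.toSubmodule ≠ ⊥ := fun h => hσ.1 (Subrepresentation.toSubmodule_injective h)
  have htop : σ.toSubmodule ≠ ⊤ := fun h => hσ.2 (Subrepresentation.toSubmodule_injective h)
  have hle : ∀ g, σ.toSubmodule ≤ σ.toSubmodule.comap (X g) := fun g x hx =>
    σ.apply_mem_toSubmodule g hx
  obtain ⟨Y, ⟨e⟩⟩ := exists_equiv_fin σ.toRepresentation
  obtain ⟨Z, ⟨e'⟩⟩ := exists_equiv_fin (X.quotient σ.toSubmodule hle)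
  have hsum := σ.toSubmodule.finrank_quotient_add_finrank
  have hpos : 0 < finrank k σ.toSubmodule :=
    Nat.pos_of_ne_zero fun h => hbot (Submodule.finrank_eq_zero.mp h)
  have hlt := Submodule.finrank_lt htop
  rw [Module.finrank_fin_fun] at hsum hlt
  refine ⟨_, _, Y, Z, hlt, by omega, fun g => ?_⟩
  rw [charpoly_eq_of_equiv e, charpoly_eq_of_equiv e', charpoly_eq_mul_of_le_comap _ _ (hle g)]
  rfl

/-- Induction on the degree: characteristic polynomials multiply along a subrepresentation and its
quotient, so Brauer characters add. -/
theorem brauerCharacter_mem_closure {n : ℕ} (X : Representation (F I) G (Fin n → F I)) :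
    brauerCharacter p I X ∈ AddSubmonoid.closure (IBr G p I) := by
  induction n using Nat.strong_induction_on with
  | _ n ih =>
    by_cases hX : X.IsIrreducible
    · exact AddSubmonoid.subset_closure ⟨n, X, hX, rfl⟩
    by_cases hn : n = 0
    · subst hn
      have : brauerCharacter p I X = 0 := by
        funext g
        have h1 : (X g).charpoly = 1 := by
          rw [← Polynomial.Monic.natDegree_eq_zero (X g).charpoly_monic,
            LinearMap.charpoly_natDegree, finrank_fin_fun]
        simp [brauerCharacter, h1]
      exact this ▸ zero_mem _
    · have : Infinite (F I) := IsAlgClosed.instInfinite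
      obtain ⟨n₁, n₂, Y, Z, h₁, h₂, h⟩ := exists_charpoly_eq_mul X hn hX
      rw [brauerCharacter_eq_add h]
      exact add_mem (ih _ h₁ Y) (ih _ h₂ Z)

/-- χ̂ is the Brauer character of the reduction of a model over V: at a p-regular element the
eigenvalues are roots of unity of order prime to p, and `rootLift` recovers them from their
reductions. -/
theorem hat_character_mem_closure [Finite G] (hp : p.Prime) (hpI : (p : R) ∈ I) {n : ℕ}
    (X : Representation K G (Fin n → K)) :
    hat p X.character ∈ AddSubmonoid.closure (IBr G p I) := by
  obtain ⟨V, hRV, π, hπ⟩ := exists_valuationSubring_hom hp I hpI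
  obtain ⟨m, M, hM⟩ := exists_integral_model V X
  let Y : Representation (F I) G (Fin m → F I) :=
    { toFun := fun g => Matrix.toLin' ((M g).map π)
      map_one' := by simp [Matrix.map_one]; rfl
      map_mul' := fun g h => by rw [map_mul, Matrix.map_mul, Matrix.toLin'_mul]; rfl }
  have hY : ∀ g, (Y g).charpoly = (M g).charpoly.map π := fun g => by
    rw [← Matrix.charpoly_map]
    exact Matrix.charpoly_toLin' _
  suffices hat p X.character = brauerCharacter p I Y from this ▸ brauerCharacter_mem_closure Y
  funext g
  by_cases hg : p ∣ orderOf g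
  · rw [hat, if_pos hg, brauerCharacter_of_dvd Y hg]
  rw [hat, if_neg hg, brauerCharacter_of_not_dvd Y hg]
  have hroots : ∀ z ∈ (X g).charpoly.roots, z ^ pPrimePart p G = 1 := fun z hz =>
    pow_eq_one_of_mem_roots_charpoly (apply_pow_pPrimePart hp X hg) hz
  have hpos : 0 < pPrimePart p G :=
    Nat.pos_of_ne_zero fun h => not_dvd_pPrimePart (G := G) hp (h ▸ dvd_zero p)
  obtain ⟨s, hs⟩ : ∃ s : Multiset R, s.map Subtype.val = (X g).charpoly.roots := by
    refine ⟨(X g).charpoly.roots.pmap Subtype.mk fun z hz => ?_, by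
      simp [Multiset.map_pmap, Multiset.pmap_eq_map]⟩
    exact IsIntegral.of_pow hpos (by rw [hroots z hz]; exact isIntegral_one)
  have hs1 : ∀ z ∈ s, z ^ pPrimePart p G = 1 := fun z hz =>
    Subtype.val_injective (hroots z (hs ▸ Multiset.mem_map_of_mem _ hz))
  have hMs : (M g).charpoly = (s.map fun z : R => Polynomial.X - Polynomial.C ⟨(z : K), hRV z⟩).prod := by
    apply Polynomial.map_injective (algebraMap V K) (FaithfulSMul.algebraMap_injective V K)
    rw [← hM, (IsAlgClosed.splits (X g).charpoly).eq_prod_roots_of_monic (X g).charpoly_monic, ← hs,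
      Polynomial.map_multiset_prod, Multiset.map_map, Multiset.map_map]
    congr 1
    refine Multiset.map_congr rfl fun z _ => ?_
    simp
  have hYs : (Y g).charpoly.roots = s.map (Ideal.Quotient.mk I) := by
    rw [hY, hMs, Polynomial.map_multiset_prod, Multiset.map_map]
    have : (fun z : R => Polynomial.map π (Polynomial.X - Polynomial.C ⟨(z : K), hRV z⟩)) =
        fun z => Polynomial.X - Polynomial.C (Ideal.Quotient.mk I z) := by
      funext z
      simp [hπ]
    rw [show (Polynomial.map π ∘ fun z : R => Polynomial.X - Polynomial.C ⟨(z : K), hRV z⟩) = _ from this]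
    refine Eq.trans (congrArg (fun t => Polynomial.roots (Multiset.prod t)) ?_)
      (Polynomial.roots_multiset_prod_X_sub_C _)
    exact (Multiset.map_map (fun x => Polynomial.X - Polynomial.C x) (Ideal.Quotient.mk I) s).symm
  rw [hYs, Multiset.map_map, character,
    Module.End.trace_eq_sum_roots_charpoly_of_splits (IsAlgClosed.splits _), ← hs]
  exact congrArg _ (Multiset.map_congr rfl fun z hz =>
    (rootLift_mk hp hpI (not_dvd_pPrimePart hp) (hs1 z hz)).symm)

end Brauer

end BrauerAtoms

namespace BrauerAtoms

open Module Representation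

/-! ### The inner product as a biadditive pairing. -/

section Inner

variable {G : Type*} [Fintype G]

variable (G) in
/-- `charInner` as a biadditive map. -/
noncomputable def charInnerHom : (G → K) →ₗ[ℤ] (G → K) →ₗ[ℤ] ℂ :=
  LinearMap.mk₂ ℤ charInner
    (fun x y z => by simp [charInner, add_mul, mul_add, Finset.sum_add_distrib])
    (fun c x y => by simp [charInner, mul_assoc, Finset.mul_sum, mul_left_comm])
    (fun x y z => by simp [charInner, mul_add, Finset.sum_add_distrib])
    (fun c x y => by simp [charInner, Finset.mul_sum, mul_left_comm])

theorem charInnerHom_apply (f h : G → K) : charInnerHom G f h = charInner f h := rfl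

theorem conj_charInner (f h : G → K) : (starRingEnd ℂ) (charInner f h) = charInner h f := by
  simp [charInner, mul_comm]

theorem charInner_smul_left (a : K) (f h : G → K) : charInner (a • f) h = a * charInner f h := by
  simp only [charInner, Pi.smul_apply, smul_eq_mul, MulMemClass.coe_mul, mul_assoc, ← Finset.mul_sum]
  ring

end Inner

/-! ### Ordinary characters and the duality of PIMs with IBr(G). -/

section Ordinary

variable {G : Type*} [Group G] {p : ℕ} {I : Ideal R} [I.IsMaximal]

theorem conj_character {n : ℕ} [Finite G] (X : Representation K G (Fin n → K)) (g : G) :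
    (starRingEnd ℂ) (X.character g) = (X.character g⁻¹ : K) := by
  let M : G →* Matrix (Fin n) (Fin n) ℂ :=
    (algebraMap K ℂ).mapMatrix.toMonoidHom.comp 
      ((LinearMap.toMatrixAlgEquiv' : End K (Fin n → K) ≃ₐ[K] _).toMulEquiv.toMonoidHom.comp X)
  have hM : ∀ g, (X.character g : ℂ) = (M g).trace := by
    intro g
    rw [character, LinearMap.trace_eq_matrix_trace K (Pi.basisFun K (Fin n))]
    exact AddMonoidHom.map_trace (algebraMap K ℂ) (LinearMap.toMatrix' (X g))
  rw [hM, hM, conj_trace_eq_trace_inv]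

theorem linearIndepOn_Irr : LinearIndepOn K id (Irr G) := by
  choose n X hX hχ using fun χ : Irr G => χ.2
  rw [LinearIndepOn, linearIndependent_iff_finset_linearIndependent]
  intro s
  have := linearIndependent_character (fun χ : s => X χ) (fun χ => hX χ) fun χ ψ hne =>
    ⟨fun e => hne <| Subtype.ext <| Subtype.ext <| by rw [hχ χ, hχ ψ, char_iso e]⟩
  convert this using 2 with χ
  exact hχ χ

theorem finite_Irr [Finite G] : (Irr G).Finite :=
  linearIndepOn_Irr.finite

theorem finite_IBr [Finite G] (hp : p.Prime) (hpI : (p : R) ∈ I) : (IBr G p I).Finite :=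
  (linearIndepOn_IBr hp hpI).finite

variable [Fintype G]

theorem charInner_eq_ite [DecidableEq (G → K)] {χ ψ : G → K} (hχ : χ ∈ Irr G) (hψ : ψ ∈ Irr G) :
    charInner χ ψ = if χ = ψ then 1 else 0 := by
  have key : ∀ {n n' : ℕ} (X : Representation K G (Fin n → K))
      (Y : Representation K G (Fin n' → K)), charInner X.character Y.character =
        (((Nat.card G : K)⁻¹ * ∑ g : G, X.character g * Y.character g⁻¹ : K) : ℂ) := by
    intro n n' X Y
    simp [charInner, conj_character, Nat.card_eq_fintype_card]
  have : Invertible (Nat.card G : K) := invertibleOfNonzero (by exact_mod_cast Nat.card_pos.ne')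
  obtain ⟨n, X, hX, rfl⟩ := hχ
  obtain ⟨n', Y, hY, rfl⟩ := hψ
  split_ifs with h
  · rw [← h, key, char_orthonormal, if_pos ⟨Representation.Equiv.refl X⟩]
    rfl
  · rw [key, char_orthonormal, if_neg fun ⟨e⟩ => h (char_iso e).symm]
    rfl

/-- Irreducible characters span the class functions. -/
theorem exists_eq_sum_smul_Irr {f : G → K} (hf : ∀ g h, f (h * g * h⁻¹) = f g) :
    ∃ c : (G → K) → K, (∀ χ ∈ Irr G, (c χ : ℂ) = charInner f χ) ∧
      f = ∑ χ ∈ finite_Irr.toFinset, c χ • χ := by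
  classical
  -- Using χ g⁻¹ for the complex conjugate of χ g keeps the coefficients in K.
  let c : (G → K) → K := fun χ => (Nat.card G : K)⁻¹ * ∑ g, f g * χ g⁻¹
  have hc : ∀ χ ∈ Irr G, (c χ : ℂ) = charInner f χ := by
    rintro _ ⟨n, X, hX, rfl⟩
    simp [c, charInner, conj_character, Nat.card_eq_fintype_card]
  refine ⟨c, hc, ?_⟩
  rw [← sub_eq_zero]
  refine eq_zero_of_forall_sum_mul_character_eq_zero _ (fun g h => ?_) fun n X hX => ?_
  · have : ∀ χ ∈ Irr G, χ (h * g * h⁻¹) = χ g := by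
      rintro _ ⟨n, X, hX, rfl⟩
      exact char_conj X g h
    simp only [Pi.sub_apply, Finset.sum_apply, Pi.smul_apply, hf]
    congr 1
    exact Finset.sum_congr rfl fun χ hχ => by rw [this χ (finite_Irr.mem_toFinset.mp hχ)]
  · have hXI : X.character ∈ Irr G := ⟨n, X, hX, rfl⟩
    set f' := f - ∑ χ ∈ finite_Irr.toFinset, c χ • χ with hf'
    have h0 : charInner f' X.character = 0 := by
      rw [hf', ← charInnerHom_apply, map_sub, map_sum, LinearMap.sub_apply, LinearMap.sum_apply,
        Finset.sum_eq_single X.character]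
      · rw [charInnerHom_apply, charInnerHom_apply, charInner_smul_left, charInner_eq_ite hXI hXI,
          if_pos rfl, mul_one, hc _ hXI, sub_self]
      · intro χ hχ hne
        rw [charInnerHom_apply, charInner_smul_left,
          charInner_eq_ite (finite_Irr.mem_toFinset.mp hχ) hXI, if_neg hne, mul_zero]
      · exact fun h => absurd (finite_Irr.mem_toFinset.mpr hXI) h
    have hcard : (Fintype.card G : ℂ)⁻¹ ≠ 0 := by simp
    have h1 := (mul_eq_zero.mp h0).resolve_left hcard
    apply Subtype.val_injective
    simpa [conj_character] using h1

theorem hat_eq_sum_decompositionNumber (hp : p.Prime) (hpI : (p : R) ∈ I) {χ : G → K}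
    (hχ : χ ∈ Irr G) :
    hat p χ = ∑ φ ∈ (finite_IBr (G := G) hp hpI).toFinset, decompositionNumber p I χ φ • φ := by
  obtain ⟨n, X, hX, rfl⟩ := hχ
  have hex : ∃ d, IsDecomposition p I X.character d := by
    have h1 := hat_character_mem_closure hp hpI X
    rw [← Submodule.span_nat_eq_addSubmonoidClosure, Submodule.mem_toAddSubmonoid] at h1
    obtain ⟨d, hd, hd'⟩ := Submodule.mem_span_set.mp h1
    exact ⟨d, hd, hd'.symm⟩
  simp only [decompositionNumber, dif_pos hex]
  rw [hex.choose_spec.2]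
  exact Finsupp.sum_of_support_subset _
    (fun φ hφ => (finite_IBr hp hpI).mem_toFinset.mpr (hex.choose_spec.1 hφ)) _ (by simp)

theorem PIM_eq_sum (φ : G → K) :
    PIM p I φ = ∑ χ ∈ finite_Irr.toFinset, decompositionNumber p I χ φ • χ :=
  finsum_mem_eq_finite_toFinset_sum _ finite_Irr

/-- Projective indecomposable characters and irreducible Brauer characters are dual. -/
theorem charInner_PIM [DecidableEq (G → K)] (hp : p.Prime) (hpI : (p : R) ∈ I) {φ ψ : G → K}
    (hφ : φ ∈ IBr G p I) (hψ : ψ ∈ IBr G p I) :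
    charInner (PIM p I φ) ψ = if φ = ψ then 1 else 0 := by
  obtain ⟨c, hc, hψc⟩ : ∃ c : (G → K) → K, (∀ χ ∈ Irr G, (c χ : ℂ) = charInner ψ χ) ∧
      ψ = ∑ χ ∈ finite_Irr.toFinset, c χ • χ := by
    refine exists_eq_sum_smul_Irr fun g h => ?_
    obtain ⟨n, X, hX, rfl⟩ := hψ
    exact brauerCharacter_conj X g h
  let T := (finite_IBr (G := G) hp hpI).toFinset
  let a : (G → K) → K := fun φ => ∑ χ ∈ finite_Irr.toFinset, c χ * decompositionNumber p I χ φ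
  have hψ0 : ∀ g, p ∣ orderOf g → ψ g = 0 := by
    obtain ⟨n, X, hX, rfl⟩ := hψ
    exact fun g hg => brauerCharacter_of_dvd X hg
  -- Truncation to p-regular elements fixes ψ, so it can be applied to each term of the expansion.
  have h1 : ψ = ∑ χ ∈ finite_Irr.toFinset, c χ • hat p χ := by
    funext g
    by_cases hg : p ∣ orderOf g
    · simp [hat, hg, hψ0]
    · conv_lhs => rw [hψc]
      simp [hat, hg]
  have h2 : ψ = ∑ φ ∈ T, a φ • φ := by
    conv_lhs => rw [h1, Finset.sum_congr rfl fun χ hχ => by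
      rw [hat_eq_sum_decompositionNumber hp hpI (finite_Irr.mem_toFinset.mp hχ), Finset.smul_sum]]
    rw [Finset.sum_comm]
    refine Finset.sum_congr rfl fun φ _ => ?_
    rw [Finset.sum_smul]
    refine Finset.sum_congr rfl fun χ _ => ?_
    rw [mul_smul, Nat.cast_smul_eq_nsmul]
  have ha : a φ = if φ = ψ then 1 else 0 := by
    have hli := linearIndepOn_iff'.mp (linearIndepOn_IBr (G := G) hp hpI) T
      (fun φ => a φ - if φ = ψ then 1 else 0)
      (fun φ hφ => (finite_IBr hp hpI).mem_toFinset.mp hφ) (by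
        have hψT : ψ ∈ T := (finite_IBr hp hpI).mem_toFinset.mpr hψ
        simp only [id, sub_smul, Finset.sum_sub_distrib, ← h2, ite_smul, one_smul, zero_smul]
        simp [hψT])
    exact sub_eq_zero.mp (hli φ ((finite_IBr hp hpI).mem_toFinset.mpr hφ))
  have h3 : charInner ψ (PIM p I φ) = (a φ : ℂ) := by
    rw [PIM_eq_sum, ← charInnerHom_apply, map_sum]
    simp only [a, AddSubmonoidClass.coe_finsetSum, map_nsmul]
    refine Finset.sum_congr rfl fun χ hχ => ?_
    rw [charInnerHom_apply, ← hc χ (finite_Irr.mem_toFinset.mp hχ)]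
    simp [mul_comm]
  rw [← conj_charInner, h3, ha]
  split_ifs <;> simp

end Ordinary

end BrauerAtoms

namespace BrauerAtoms

open Module

/-! ### Atoms of a free additive monoid. -/

section Atoms

variable {M : Type*} [AddCommGroup M]

/-- Members of a linearly independent set are atoms of the additive monoid it generates. -/
theorem eq_zero_or_eq_zero_of_mem_of_linearIndepOn {A : Set M} (hA : LinearIndepOn ℤ id A)
    {a x y : M} (ha : a ∈ A) (hx : x ∈ AddSubmonoid.closure A) (hy : y ∈ AddSubmonoid.closure A)
    (h : a = x + y) : x = 0 ∨ y = 0 := by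
  have hAN : LinearIndepOn ℕ id A := hA.restrict_scalars (R := ℕ) fun m n hmn => by simpa using hmn
  rw [← Submodule.span_nat_eq_addSubmonoidClosure, Submodule.mem_toAddSubmonoid,
    ← Subtype.range_coe (s := A), Finsupp.mem_span_range_iff_exists_finsupp] at hx hy
  obtain ⟨c, rfl⟩ := hx
  obtain ⟨d, rfl⟩ := hy
  -- Coordinates are natural numbers with sum 1 at a and 0 elsewhere, so one of the two families is
  -- zero.
  have hcd : c + d = Finsupp.single ⟨a, ha⟩ 1 := by
    apply hAN
    rw [map_add, Finsupp.linearCombination_single, one_smul]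
    exact h.symm
  have h1 : c ⟨a, ha⟩ + d ⟨a, ha⟩ = 1 := by
    simpa using DFunLike.congr_fun hcd ⟨a, ha⟩
  have h2 : ∀ i, i ≠ ⟨a, ha⟩ → c i = 0 ∧ d i = 0 := by
    intro i hi
    have := DFunLike.congr_fun hcd i
    rw [Finsupp.single_eq_of_ne hi, Finsupp.add_apply] at this
    omega
  rcases Nat.eq_zero_or_pos (c ⟨a, ha⟩) with hc | hc
  · left
    have : c = 0 := by
      ext i
      by_cases hi : i = ⟨a, ha⟩
      · rw [hi, hc]; rfl
      · exact (h2 i hi).1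
    simp [this]
  · right
    have : d = 0 := by
      ext i
      by_cases hi : i = ⟨a, ha⟩
      · rw [hi]; simp; omega
      · exact (h2 i hi).2
    simp [this]

theorem exists_eq_add_of_mem_closure {A : Set M} {x : M} (hx : x ∈ AddSubmonoid.closure A)
    (h0 : x ≠ 0) : ∃ a ∈ A, ∃ y ∈ AddSubmonoid.closure A, x = a + y := by
  induction hx using AddSubmonoid.closure_induction with
  | mem x hx => exact ⟨x, hx, 0, zero_mem _, (add_zero x).symm⟩
  | zero => exact absurd rfl h0
  | add x y hx hy ihx ihy =>
    by_cases h : x = 0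
    · subst h
      simpa using ihy (by simpa using h0)
    · obtain ⟨a, ha, z, hz, rfl⟩ := ihx h
      exact ⟨a, ha, z + y, add_mem hz hy, add_assoc _ _ _⟩

theorem linearIndependent_of_dual {β : M →ₗ[ℤ] M →ₗ[ℤ] ℂ} {ι : Type*} [DecidableEq ι] {e b : ι → M}
    (h : ∀ i j, β (e i) (b j) = if i = j then 1 else 0) : LinearIndependent ℤ e := by
  rw [linearIndependent_iff']
  intro s c hc i hi
  have := congrArg (fun x => β x (b i)) hc
  simpa [h, hi] using this

end Atoms

/-! ### ℤ-duality for S and Φ (applied to IBr(G) and `PIM`), restricted to a finite T ⊆ S (the set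
IBr(B)). -/

section Duality

variable {M : Type*} [AddCommGroup M] [DecidableEq M] {β : M →ₗ[ℤ] M →ₗ[ℤ] ℂ} {S : Set M} {Φ : M → M}

theorem sum_smul_eq_of_mem_span (hβ : ∀ φ ∈ S, ∀ ψ ∈ S, β (Φ φ) ψ = if φ = ψ then 1 else 0)
    {T : Finset M} (hT : ↑T ⊆ S) {x : M} (hx : x ∈ Submodule.span ℤ (Φ '' T)) :
    ∃ n : M → ℤ, x = ∑ φ ∈ T, n φ • Φ φ ∧ ∀ φ ∈ S, β x φ = if φ ∈ T then n φ else 0 := by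
  obtain ⟨n, hn⟩ : ∃ n : M → ℤ, ∑ φ ∈ T, n φ • Φ φ = x := by
    obtain ⟨c, hc⟩ := (Submodule.mem_span_image_finset_iff_exists_fun ℤ).mp hx
    refine ⟨fun φ => if h : φ ∈ T then c ⟨φ, h⟩ else 0, ?_⟩
    rw [← hc, ← Finset.sum_coe_sort]
    simp
  refine ⟨n, hn.symm, fun φ hφ => ?_⟩
  rw [← hn, map_sum, LinearMap.sum_apply]
  rw [Finset.sum_congr rfl fun ψ hψ => by
    rw [map_zsmul, LinearMap.smul_apply, hβ ψ (hT hψ) φ hφ]]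
  simp

/-- An element of the span of the dual family is determined by its pairings. -/
theorem eq_zero_of_mem_span (hβ : ∀ φ ∈ S, ∀ ψ ∈ S, β (Φ φ) ψ = if φ = ψ then 1 else 0)
    {T : Finset M} (hT : ↑T ⊆ S) {x : M} (hx : x ∈ Submodule.span ℤ (Φ '' T))
    (h0 : ∀ φ ∈ T, β x φ = 0) : x = 0 := by
  obtain ⟨n, hn, hn'⟩ := sum_smul_eq_of_mem_span hβ hT hx
  rw [hn]
  refine Finset.sum_eq_zero fun φ hφ => ?_
  have := (hn' φ (hT hφ)).symm.trans (h0 φ hφ)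
  rw [if_pos hφ, Int.cast_eq_zero] at this
  rw [this, zero_smul]

theorem eq_of_mem_span (hβ : ∀ φ ∈ S, ∀ ψ ∈ S, β (Φ φ) ψ = if φ = ψ then 1 else 0)
    {T : Finset M} (hT : ↑T ⊆ S) {B : Set M} (hB : Submodule.span ℤ B = Submodule.span ℤ (T : Set M))
    {x y : M} (hx : x ∈ Submodule.span ℤ (Φ '' T)) (hy : y ∈ Submodule.span ℤ (Φ '' T))
    (h : ∀ θ ∈ B, β x θ = β y θ) : x = y := by
  rw [← sub_eq_zero]
  refine eq_zero_of_mem_span hβ hT (sub_mem hx hy) fun φ hφ => ?_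
  have hle : Submodule.span ℤ B ≤ LinearMap.ker (β (x - y)) := Submodule.span_le.mpr fun θ hθ => by
    simp [h θ hθ]
  exact hle (hB ▸ Submodule.subset_span hφ)

theorem exists_nat_eq_of_mem_closure
    (hβ : ∀ φ ∈ S, ∀ ψ ∈ S, β (Φ φ) ψ = if φ = ψ then 1 else 0) {x y : M}
    (hx : x ∈ AddSubmonoid.closure (Φ '' S)) (hy : y ∈ AddSubmonoid.closure S) :
    ∃ n : ℕ, β x y = n := by
  have h1 : ∀ φ ∈ S, ∃ n : ℕ, β (Φ φ) y = n := by
    intro φ hφ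
    induction hy using AddSubmonoid.closure_induction with
    | mem y hy => exact ⟨if φ = y then 1 else 0, by rw [hβ φ hφ y hy]; simp⟩
    | zero => exact ⟨0, by simp⟩
    | add y z _ _ h₁ h₂ =>
      obtain ⟨m, hm⟩ := h₁
      obtain ⟨n, hn⟩ := h₂
      exact ⟨m + n, by simp [hm, hn]⟩
  induction hx using AddSubmonoid.closure_induction with
  | mem x hx =>
    obtain ⟨φ, hφ, rfl⟩ := hx
    exact h1 φ hφ
  | zero => exact ⟨0, by simp⟩
  | add x z _ _ h₁ h₂ =>
    obtain ⟨m, hm⟩ := h₁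
    obtain ⟨n, hn⟩ := h₂
    exact ⟨m + n, by simp [hm, hn]⟩

/-- Ensures that a projective character lying in K₀(B) is a sum of PIMs of B itself: its integer
coefficients are pairings with elements of T, hence non-negative. -/
theorem mem_closure_image_of_mem_span
    (hβ : ∀ φ ∈ S, ∀ ψ ∈ S, β (Φ φ) ψ = if φ = ψ then 1 else 0)
    {T : Finset M} (hT : ↑T ⊆ S) {x : M} (hx : x ∈ Submodule.span ℤ (Φ '' T))
    (hx' : x ∈ AddSubmonoid.closure (Φ '' S)) : x ∈ AddSubmonoid.closure (Φ '' T) := by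
  obtain ⟨n, hn, hn'⟩ := sum_smul_eq_of_mem_span hβ hT hx
  rw [hn]
  refine sum_mem fun φ hφ => ?_
  obtain ⟨m, hm⟩ := exists_nat_eq_of_mem_closure hβ hx' (AddSubmonoid.subset_closure (hT hφ))
  have : n φ = m := by
    have := (hn' φ (hT hφ)).symm.trans hm
    rw [if_pos hφ] at this
    exact_mod_cast this
  rw [this, natCast_zsmul]
  exact nsmul_mem (AddSubmonoid.subset_closure (Set.mem_image_of_mem Φ hφ)) m

/-- A basis of the span of `T` has a dual basis in the span of `Φ '' T`. -/
theorem exists_dual_family (hβ : ∀ φ ∈ S, ∀ ψ ∈ S, β (Φ φ) ψ = if φ = ψ then 1 else 0)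
    {T : Finset M} (hT : ↑T ⊆ S) {B : Set M} (hB : LinearIndepOn ℤ id B)
    (hB' : Submodule.span ℤ B = Submodule.span ℤ (T : Set M)) :
    ∃ e : B → M, (∀ θ, e θ ∈ Submodule.span ℤ (Φ '' T)) ∧
      ∀ θ η : B, β (e θ) η = if θ = η then 1 else 0 := by
  have hTB : ∀ φ ∈ T, φ ∈ Submodule.span ℤ (Set.range ((↑) : B → M)) := fun φ hφ => by
    rw [Subtype.range_coe, hB']
    exact Submodule.subset_span hφ
  -- The θ-coordinate of φ in the basis B. With these coefficients, pairing with `e θ` is the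
  -- θ-coordinate functional on the whole span (`hrepr`).
  let c (θ : B) : M → ℤ := fun φ =>
    if h : φ ∈ T then LinearIndependent.repr hB ⟨φ, hTB φ h⟩ θ else 0
  let e (θ : B) : M := ∑ φ ∈ T, c θ φ • Φ φ
  have hrepr : ∀ θ, ∀ y (hy : y ∈ Submodule.span ℤ (T : Set M))
      (hy' : y ∈ Submodule.span ℤ (Set.range ((↑) : B → M))),
      β (e θ) y = (LinearIndependent.repr hB ⟨y, hy'⟩ θ : ℤ) := by
    intro θ y hy
    induction hy using Submodule.span_induction with
    | mem y hy =>
      intro hy'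
      rw [map_sum, LinearMap.sum_apply, Finset.sum_eq_single y]
      · rw [map_zsmul, LinearMap.smul_apply, hβ y (hT hy) y (hT hy), if_pos rfl]
        have hy : y ∈ T := hy
        simp [c, hy]
      · intro φ hφ hne
        rw [map_zsmul, LinearMap.smul_apply, hβ φ (hT hφ) y (hT hy), if_neg hne, smul_zero]
      · exact fun h => absurd hy h
    | zero => 
      intro hy'
      rw [map_zero, show (⟨0, hy'⟩ : Submodule.span ℤ (Set.range ((↑) : B → M))) = 0 from rfl, map_zero]
      simp
    | add x y hx hy ihx ihy =>
      intro hy'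
      have h1 : ∀ z ∈ Submodule.span ℤ (T : Set M), z ∈ Submodule.span ℤ (Set.range ((↑) : B → M)) := by
        rw [Subtype.range_coe, hB']
        exact fun z hz => hz
      rw [map_add, ihx (h1 x hx), ihy (h1 y hy), ← Int.cast_add, ← Finsupp.add_apply, ← map_add]
      rfl
    | smul a x hx ihx =>
      intro hy'
      have h1 : x ∈ Submodule.span ℤ (Set.range ((↑) : B → M)) := by
        rwa [Subtype.range_coe, hB']
      rw [map_zsmul, ihx h1, zsmul_eq_mul, ← Int.cast_mul, ← smul_eq_mul, ← Finsupp.smul_apply,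
        ← map_smul]
      rfl
  refine ⟨e, fun θ => sum_mem fun φ hφ => zsmul_mem
    (Submodule.subset_span (Set.mem_image_of_mem Φ hφ)) _, fun θ η => ?_⟩
  have hη : (η : M) ∈ Submodule.span ℤ (Set.range ((↑) : B → M)) :=
    Submodule.subset_span (Set.mem_range_self η)
  rw [hrepr θ η (hB' ▸ Submodule.subset_span η.2) hη,
    LinearIndependent.repr_eq_single hB η ⟨η, hη⟩ rfl]
  simp [Finsupp.single_apply, eq_comm]

/-- Both sides have the same pairings with B, and these determine an element of the span of `Φ ''
T`. -/
theorem eq_sum_of_dual (hβ : ∀ φ ∈ S, ∀ ψ ∈ S, β (Φ φ) ψ = if φ = ψ then 1 else 0)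
    {T : Finset M} (hT : ↑T ⊆ S) {B : Set M} [Fintype B]
    (hB : Submodule.span ℤ B = Submodule.span ℤ (T : Set M)) {e : B → M}
    (he : ∀ θ, e θ ∈ Submodule.span ℤ (Φ '' T))
    (he' : ∀ θ η : B, β (e θ) η = if θ = η then 1 else 0) {x : M}
    (hx : x ∈ Submodule.span ℤ (Φ '' T)) {n : B → ℤ} (hn : ∀ θ : B, β x θ = n θ) :
    x = ∑ θ, n θ • e θ := by
  refine eq_of_mem_span hβ hT hB hx (sum_mem fun θ _ => zsmul_mem (he θ) _) fun θ hθ => ?_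
  rw [hn ⟨θ, hθ⟩, map_sum, LinearMap.sum_apply]
  simp [fun η => he' η ⟨θ, hθ⟩]

theorem exists_int_eq_of_mem_span
    (hβ : ∀ φ ∈ S, ∀ ψ ∈ S, β (Φ φ) ψ = if φ = ψ then 1 else 0)
    {T : Finset M} (hT : ↑T ⊆ S) {x y : M} (hx : x ∈ Submodule.span ℤ (Φ '' T))
    (hy : y ∈ Submodule.span ℤ (T : Set M)) : ∃ n : ℤ, β x y = n := by
  obtain ⟨n, -, hn⟩ := sum_smul_eq_of_mem_span hβ hT hx
  induction hy using Submodule.span_induction with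
  | mem y hy => exact ⟨n y, by rw [hn y (hT hy), if_pos (Finset.mem_coe.mp hy)]⟩
  | zero => exact ⟨0, by simp⟩
  | add y z _ _ h₁ h₂ =>
    obtain ⟨k, hk⟩ := h₁
    obtain ⟨l, hl⟩ := h₂
    exact ⟨k + l, by simp [hk, hl]⟩
  | smul a y _ h =>
    obtain ⟨k, hk⟩ := h
    exact ⟨a * k, by simp [hk]⟩

end Duality

end BrauerAtoms

namespace BrauerAtoms

open Module

/-! ### PIMs are indecomposable; proof of the theorem. -/

section Main

variable {G : Type*} [Group G] [Fintype G] {p : ℕ} {I : Ideal R} [I.IsMaximal]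

theorem linearIndepOn_IPr (hp : p.Prime) (hpI : (p : R) ∈ I) :
    LinearIndepOn ℤ id (IPr G p I) := by
  classical
  refine LinearIndepOn.id_image (LinearIndepOn.of_comp LinearMap.id ?_)
  refine linearIndependent_of_dual (β := charInnerHom G) (b := fun φ : IBr G p I => φ.1) fun φ ψ => ?_
  simpa [Subtype.ext_iff, charInnerHom_apply] using charInner_PIM hp hpI φ.2 ψ.2

theorem isIndecomposable_PIM (hp : p.Prime) (hpI : (p : R) ∈ I) {φ : G → K} (hφ : φ ∈ IBr G p I) :
    IsIndecomposable p I (PIM p I φ) := by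
  have hmem : PIM p I φ ∈ IPr G p I := Set.mem_image_of_mem _ hφ
  exact ⟨AddSubmonoid.subset_closure hmem, (linearIndepOn_IPr hp hpI).ne_zero hmem,
    fun Ψ₁ Ψ₂ h₁ h₂ h =>
      eq_zero_or_eq_zero_of_mem_of_linearIndepOn (linearIndepOn_IPr hp hpI) hmem h₁ h₂ h⟩

end Main

end BrauerAtoms

theorem mainTheorem6 {G : Type*} [Group G] [Fintype G] (p : ℕ) (hp : p.Prime)
    (I : Ideal BrauerAtoms.R) [I.IsMaximal] (hpI : (p : BrauerAtoms.R) ∈ I)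
    (B : Set (BrauerAtoms.Irr G)) (hB : BrauerAtoms.IsUnionOfBlocks p I B) :
    (∀ BS : Set (G → BrauerAtoms.K), BrauerAtoms.IsBasicSetBrauer p I B BS →
      (∃! PA : Set (G → BrauerAtoms.K), BrauerAtoms.IsDualBasis p I B BS PA) ∧
      ∀ PA : Set (G → BrauerAtoms.K), BrauerAtoms.IsDualBasis p I B BS PA →
        BrauerAtoms.IsSystemOfProjectiveAtoms p I B PA) ∧
    (∀ PA : Set (G → BrauerAtoms.K), BrauerAtoms.IsSystemOfProjectiveAtoms p I B PA →
      ∀ Φ ∈ PA, BrauerAtoms.IsProjectiveCharacter p I Φ →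
        BrauerAtoms.IsIndecomposable p I Φ ∧ Φ ∈ BrauerAtoms.IPrOf p I B) := by
  classical
  open BrauerAtoms in
  let β := charInnerHom G
  have hβ : ∀ φ ∈ IBr G p I, ∀ ψ ∈ IBr G p I, β (PIM p I φ) ψ = if φ = ψ then 1 else 0 :=
    fun φ hφ ψ hψ => charInner_PIM hp hpI hφ hψ
  obtain ⟨T, hT⟩ : ∃ T : Finset (G → K), (T : Set (G → K)) = IBrOf p I B :=
    ((finite_IBr hp hpI).subset fun φ hφ => hφ.1).exists_finset_coe
  have hTS : (T : Set (G → K)) ⊆ IBr G p I := hT ▸ fun φ hφ => hφ.1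
  have hK : K₀ p I B = Submodule.span ℤ (PIM p I '' T) := by rw [K₀, IPrOf, hT]
  have hG : G₀ p I B = Submodule.span ℤ (T : Set (G → K)) := by rw [G₀, hT]
  refine ⟨fun BS hBS => ?_, fun PA hPA Φ hΦ hproj => ?_⟩
  · obtain ⟨⟨hli, hspan⟩, hBr⟩ := hBS
    rw [hG] at hspan
    have : Finite BS := by
      have : Module.Finite ℤ (Submodule.span ℤ (Set.range fun θ : BS => id θ.1)) := by
        rw [show (Set.range fun θ : BS => id θ.1) = BS from Subtype.range_coe, hspan]
        infer_instance
      exact Module.Finite.finite_basis (Module.Basis.span hli)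
    have := Fintype.ofFinite BS
    have hdual : ∀ {PA : Set (G → K)} (e : BS ≃ PA),
        ((∀ θ : BS, charInner (e θ).1 θ.1 = 1) ∧
          ∀ θ η : BS, θ ≠ η → charInner (e θ).1 η.1 = 0) ↔
        ∀ θ η : BS, β (e θ).1 η.1 = if θ = η then 1 else 0 := by
      intro PA e
      refine ⟨fun h θ η => ?_, fun h => ⟨fun θ => ?_, fun θ η hne => ?_⟩⟩
      · split_ifs with hθη
        · exact hθη ▸ h.1 θ
        · exact h.2 θ η hθη
      · exact (h θ θ).trans (if_pos rfl)
      · exact (h θ η).trans (if_neg hne)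
    obtain ⟨e, he, he'⟩ := exists_dual_family hβ hTS hli hspan
    -- A dual family spans over ℤ because K₀(B) and G₀(B̂) pair to integers, which serve as the
    -- coordinates.
    have hint : ∀ {f : BS → G → K}, (∀ θ, f θ ∈ Submodule.span ℤ (PIM p I '' T)) →
        (∀ θ η : BS, β (f θ) η = if θ = η then 1 else 0) →
        Submodule.span ℤ (PIM p I '' T) ≤ Submodule.span ℤ (Set.range f) := by
      intro f hf hf' x hx
      choose n hn using fun θ : BS => exists_int_eq_of_mem_span hβ hTS hx
        (hspan ▸ Submodule.subset_span θ.2)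
      rw [eq_sum_of_dual hβ hTS hspan hf hf' hx hn]
      exact sum_mem fun θ _ => zsmul_mem (Submodule.subset_span (Set.mem_range_self θ)) _
    refine ⟨⟨Set.range e, ⟨⟨?_, ?_⟩, Equiv.ofInjective e ?_, (hdual _).mpr he'⟩, ?_⟩, ?_⟩
    · exact (linearIndependent_of_dual he').linearIndepOn_id
    · rw [hK]
      refine le_antisymm (Submodule.span_le.mpr ?_) (hint he he')
      rintro _ ⟨θ, rfl⟩
      exact he θ
    · exact (linearIndependent_of_dual he').injective
    · rintro PA ⟨⟨-, hPA⟩, f, hf⟩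
      rw [hdual] at hf
      have hfe : ∀ θ, (f θ : G → K) = e θ := fun θ =>
        eq_of_mem_span hβ hTS hspan (hK ▸ hPA ▸ Submodule.subset_span (f θ).2) (he θ)
          fun η hη => (hf θ ⟨η, hη⟩).trans (he' θ ⟨η, hη⟩).symm
      ext x
      constructor
      · intro hx
        exact ⟨f.symm ⟨x, hx⟩, by rw [← hfe, Equiv.apply_symm_apply]⟩
      · rintro ⟨θ, rfl⟩
        exact hfe θ ▸ (f θ).2
    · rintro PA ⟨hPA, f, hf⟩
      rw [hdual] at hf
      refine ⟨hPA, fun Ψ hΨ hproj => ?_⟩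
      have hfmem : ∀ θ, (f θ : G → K) ∈ Submodule.span ℤ (PIM p I '' T) := fun θ =>
        hK ▸ hPA.2 ▸ Submodule.subset_span (f θ).2
      -- Non-negativity of the coordinates of Ψ uses that the members of BS are genuine Brauer
      -- characters.
      choose n hn using fun θ : BS => exists_nat_eq_of_mem_closure hβ hproj (y := θ.1) <| by
        obtain ⟨k, X, hX⟩ := hBr θ θ.2
        exact hX ▸ brauerCharacter_mem_closure X
      have hsum : Ψ = ∑ θ, (n θ : ℤ) • (f θ : G → K) :=
        eq_sum_of_dual hβ hTS hspan hfmem hf (hK ▸ hΨ) fun θ => by simp [hn θ]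
      rw [hsum]
      exact sum_mem fun θ _ => by
        rw [natCast_zsmul]
        exact nsmul_mem (AddSubmonoid.subset_closure (f θ).2) _
  · obtain ⟨⟨hli, hspan⟩, hatoms⟩ := hPA
    have hPIM : AddSubmonoid.closure (PIM p I '' T) ≤ AddSubmonoid.closure PA := by
      rw [AddSubmonoid.closure_le]
      rintro _ ⟨φ, hφ, rfl⟩
      exact hatoms _ (hK ▸ Submodule.subset_span (Set.mem_image_of_mem _ hφ))
        (AddSubmonoid.subset_closure (Set.mem_image_of_mem _ (hTS hφ)))
    have hΦK : Φ ∈ Submodule.span ℤ (PIM p I '' T) := hK ▸ hspan ▸ Submodule.subset_span hΦ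
    obtain ⟨_, ⟨φ, hφ, rfl⟩, y, hy, hΦy⟩ := exists_eq_add_of_mem_closure
      (mem_closure_image_of_mem_span hβ hTS hΦK hproj) (hli.ne_zero hΦ)
    have hind := isIndecomposable_PIM hp hpI (hTS hφ)
    -- Φ is an atom of the monoid generated by PA, which contains both the PIM and the remainder y;
    -- the PIM is nonzero.
    have hy0 : y = 0 := (eq_zero_or_eq_zero_of_mem_of_linearIndepOn hli hΦ
      (hPIM (AddSubmonoid.subset_closure (Set.mem_image_of_mem _ hφ))) (hPIM hy) hΦy).resolve_left
        hind.2.1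
    rw [hy0, add_zero] at hΦy
    rw [hΦy]
    exact ⟨hind, Set.mem_image_of_mem _ (hT ▸ hφ)⟩
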